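/- Let $\mathbb{F}_q$ be a finite field with $q$ elements, $A=\mathbb{F}_q[T]$, $F=\mathbb{F}_q(T)$, and let $\mathfrak{p}$ be a non-zero prime ideal of $A$, of degree $\deg(\mathfrak{p})=\log_q|A/\mathfrak{p}|$. Let $F_{\mathfrak p}$ and $F_\infty$ be the completions of $F$ at $\mathfrak p$ and at the place $\infty$ given by the degree. Let $\mathcal{B}'$ be a quaternion algebra over $F$ (a central simple $F$-algebra of dimension $4$) that is definite, i.e. $\mathcal{B}'\otimes_F F_\infty$ is a division algebra, and that is unramified at $\mathfrak p$; fix an isomorphism $\mathcal{B}'\otimes_F F_{\mathfrak p}\cong \mathbb{M}_2(F_{\mathfrak p})$ of $F_{\mathfrak p}$-algebras. Let $\mathcal{M}$ be a maximal $A$-order in $\mathcal{B}'$, and let $$\Gamma_0=\left(\mathcal{M}\otimes_A A[\mathfrak p^{-1}]\right)^\times/A[\mathfrak p^{-1}]^\times ,$$ which acts through $\mathrm{PGL}_2(F_{\mathfrak p})$ on the Bruhat--Tits tree $\mathscr{T}$ of $\mathrm{SL}_2(F_{\mathfrak p})$. Let $G_0=\Gamma_0\backslash\mathscr{T}$ be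 the quotient graph: its vertices and oriented edges are the $\Gamma_0$-orbits of vertices and of oriented edges of $\mathscr{T}$, $t(e)$ denotes the terminus of an oriented edge $e$, and the weight $w(x)$ of a vertex or edge $x$ of $G_0$ is the order of the stabilizer in $\Gamma_0$ of a preimage of $x$ in $\mathscr{T}$. Let $v\in V(G_0)$ be a vertex of weight $q+1$. Then every edge $e\in E(G_0)$ with $t(e)=v$ has weight $w(e)=1$ or $w(e)=q+1$. Moreover, the set $\{e\in E(G_0)\mid t(e)=v,\ w(e)=q+1\}$ is finite and $$\#\{e\in E(G_0)\mid t(e)=v,\ w(e)=q+1\}=1+(-1)^{\deg(\mathfrak p)}.$$ -/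

import Mathlib

open Polynomial IsDedekindDomain
open scoped TensorProduct Pointwise MatrixGroups

noncomputable section

/-! ### Weighted graphs and their quotients -/

/-- A graph in the sense of Serre (a set `V` of vertices, a set `E` of oriented edges, origin and
terminus maps, and an inversion of edges, where `inv e = e` is allowed), with weight functions on
vertices and edges. -/
structure WeightedGraph (V E : Type*) where
  /-- the origin of an edge -/
  o : E → V
  /-- the terminus of an edge -/
  t : E → V
  /-- the inverse edge -/
  inv : E → E
  inv_inv : ∀ e, inv (inv e) = e
  t_inv : ∀ e, t (inv e) = o e
  /-- the weight of a vertex -/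
  wV : V → ℕ
  /-- the weight of an edge -/
  wE : E → ℕ
  wE_inv : ∀ e, wE (inv e) = wE e

namespace WeightedGraph

variable {V E : Type*}

/-- The actions of `Γ` on the vertices and the edges are an action on the weighted graph. -/
structure IsAction (G : WeightedGraph V E) (Γ : Type*) [Group Γ] [MulAction Γ V]
    [MulAction Γ E] : Prop where
  smul_o : ∀ (γ : Γ) (e : E), γ • G.o e = G.o (γ • e)
  smul_inv : ∀ (γ : Γ) (e : E), G.inv (γ • e) = γ • G.inv e
  wV_smul : ∀ (γ : Γ) (v : V), G.wV (γ • v) = G.wV v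
  wE_smul : ∀ (γ : Γ) (e : E), G.wE (γ • e) = G.wE e

theorem IsAction.smul_t {G : WeightedGraph V E} {Γ : Type*} [Group Γ] [MulAction Γ V]
    [MulAction Γ E] (h : G.IsAction Γ) (γ : Γ) (e : E) : γ • G.t e = G.t (γ • e) := by
  have h1 : ∀ e, G.t e = G.o (G.inv e) := fun e => by rw [← G.t_inv, G.inv_inv]
  rw [h1, h1, h.smul_o, h.smul_inv]

theorem card_stabilizer_smul {Γ X : Type*} [Group Γ] [MulAction Γ X] (γ : Γ) (x : X) :
    Nat.card (MulAction.stabilizer Γ (γ • x)) = Nat.card (MulAction.stabilizer Γ x) :=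
  (Nat.card_congr (MulAction.stabilizerEquivStabilizer (g := γ) (a := x) rfl).toEquiv).symm

/-- The quotient of a weighted graph by a group action: vertices and edges are the orbits, and the
weight of the orbit of `x` is `|Γ_x| * w x`. (The weights are meaningful where stabilizers are
finite; `Nat.card` of an infinite stabilizer is `0`.) -/
def quotient (G : WeightedGraph V E) (Γ : Type*) [Group Γ] [MulAction Γ V] [MulAction Γ E]
    (h : G.IsAction Γ) :
    WeightedGraph (MulAction.orbitRel.Quotient Γ V) (MulAction.orbitRel.Quotient Γ E) where
  o := Quotient.map' G.o (by rintro _ e ⟨γ, rfl⟩; exact ⟨γ, h.smul_o γ e⟩)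
  t := Quotient.map' G.t (by rintro _ e ⟨γ, rfl⟩; exact ⟨γ, h.smul_t γ e⟩)
  inv := Quotient.map' G.inv (by rintro _ e ⟨γ, rfl⟩; exact ⟨γ, (h.smul_inv γ e).symm⟩)
  inv_inv := by
    intro e
    induction e using Quotient.inductionOn' with
    | h e => simp [Quotient.map'_mk'', G.inv_inv]
  t_inv := by
    intro e
    induction e using Quotient.inductionOn' with
    | h e => simp [Quotient.map'_mk'', G.t_inv]
  wV := fun v => Quotient.liftOn' v (fun v => Nat.card (MulAction.stabilizer Γ v) * G.wV v) (by
    rintro _ v ⟨γ, rfl⟩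
    simp only [card_stabilizer_smul, h.wV_smul])
  wE := fun e => Quotient.liftOn' e (fun e => Nat.card (MulAction.stabilizer Γ e) * G.wE e) (by
    rintro _ e ⟨γ, rfl⟩
    simp only [card_stabilizer_smul, h.wE_smul])
  wE_inv := by
    intro e
    induction e using Quotient.inductionOn' with
    | h e =>
      have : MulAction.stabilizer Γ (G.inv e) = MulAction.stabilizer Γ e := by
        ext γ
        simp only [MulAction.mem_stabilizer_iff, ← h.smul_inv]
        exact ⟨fun he => by rw [← G.inv_inv (γ • e), he, G.inv_inv], fun he => by rw [he]⟩
      rw [Quotient.map'_mk'', Quotient.liftOn'_mk'', Quotient.liftOn'_mk'', G.wE_inv, this]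

end WeightedGraph

/-! ### The Bruhat-Tits tree -/

namespace BruhatTits

/-- `O`-lattices in `K²`, for a discrete valuation ring `O` with fraction field `K`. -/
abbrev Lattice (O K : Type*) [CommRing O] [Field K] [Algebra O K] : Type _ :=
  {L : Submodule O (Fin 2 → K) // Submodule.IsLattice K L}

variable (O K : Type*) [CommRing O] [Field K] [Algebra O K]

/-- `GL₂(K)` acts on the lattices in `K²`, by `g • L = {g *ᵥ x | x ∈ L}`. -/
instance Lattice.mulAction : MulAction (GL (Fin 2) K) (Lattice O K) where
  smul g L := ⟨L.1.map ((Matrix.toLin' (g : Matrix (Fin 2) (Fin 2) K)).restrictScalars O), by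
    have hL := L.2
    refine ⟨hL.fg.map _, ?_⟩
    have h1 : Submodule.span K ((L.1.map ((Matrix.toLin'
        (g : Matrix (Fin 2) (Fin 2) K)).restrictScalars O) : Submodule O (Fin 2 → K)) :
          Set (Fin 2 → K)) = (Submodule.span K (L.1 : Set (Fin 2 → K))).map
            (Matrix.toLin' (g : Matrix (Fin 2) (Fin 2) K)) := by
      rw [Submodule.map_span]; rfl
    rw [h1, hL.span_eq_top, Submodule.map_top, LinearMap.range_eq_top]
    intro x
    refine ⟨(↑g⁻¹ : Matrix (Fin 2) (Fin 2) K).mulVec x, ?_⟩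
    rw [Matrix.toLin'_apply, Matrix.mulVec_mulVec, ← Units.val_mul, mul_inv_cancel,
      Units.val_one, Matrix.one_mulVec]⟩
  one_smul L := by
    apply Subtype.ext
    ext x
    change x ∈ Submodule.map _ _ ↔ _
    simp
  mul_smul g h L := by
    apply Subtype.ext
    ext x
    change x ∈ Submodule.map _ _ ↔ x ∈ Submodule.map _ (Submodule.map _ _)
    simp

theorem Lattice.smul_val (g : GL (Fin 2) K) (L : Lattice O K) :
    (g • L).1 = L.1.map
      ((Matrix.toLin' (g : Matrix (Fin 2) (Fin 2) K)).restrictScalars O) := rfl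

theorem Lattice.mem_smul {g : GL (Fin 2) K} {L : Lattice O K} {x : Fin 2 → K} :
    x ∈ (g • L).1 ↔ ∃ y ∈ L.1, (g : Matrix (Fin 2) (Fin 2) K).mulVec y = x := Iff.rfl

/-- Two lattices are homothetic if `L' = c L` for some `c ∈ Kˣ`. -/
def homothety : Setoid (Lattice O K) where
  r L L' := ∃ c : Kˣ, L'.1 = c • L.1
  iseqv :=
    { refl := fun L => ⟨1, (one_smul _ _).symm⟩
      symm := by
        rintro L L' ⟨c, hc⟩
        exact ⟨c⁻¹, by rw [hc, inv_smul_smul]⟩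
      trans := by
        rintro L L' L'' ⟨c, hc⟩ ⟨d, hd⟩
        exact ⟨d * c, by rw [hd, hc, mul_smul]⟩ }

/-- The vertices of the tree: homothety classes of lattices in `K²`. -/
def Vertex : Type _ := Quotient (homothety O K)

variable {O K}

/-- The vertex given by a lattice. -/
def Vertex.mk (L : Lattice O K) : Vertex O K := Quotient.mk (homothety O K) L

theorem Vertex.mk_eq_mk {L L' : Lattice O K} :
    Vertex.mk L = Vertex.mk L' ↔ ∃ c : Kˣ, L'.1 = c • L.1 :=
  Quotient.eq (r := homothety O K)

theorem smul_homothety (g : GL (Fin 2) K) {L L' : Lattice O K} {c : Kˣ} (h : L'.1 = c • L.1) :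
    (g • L').1 = c • (g • L).1 := by
  ext x
  rw [Lattice.mem_smul, h]
  constructor
  · rintro ⟨_, ⟨y, hy, rfl⟩, rfl⟩
    exact ⟨(g : Matrix (Fin 2) (Fin 2) K).mulVec y, ⟨y, hy, rfl⟩,
      ((g : Matrix (Fin 2) (Fin 2) K).mulVec_smul (c : K) y).symm⟩
  · rintro ⟨_, ⟨y, hy, rfl⟩, rfl⟩
    exact ⟨c • y, ⟨y, hy, rfl⟩, (g : Matrix (Fin 2) (Fin 2) K).mulVec_smul (c : K) y⟩

instance Vertex.mulActionGL : MulAction (GL (Fin 2) K) (Vertex O K) where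
  smul g := Quotient.map (g • ·) (by rintro L L' ⟨c, hc⟩; exact ⟨c, smul_homothety g hc⟩)
  one_smul v := by
    induction v using Quotient.inductionOn with
    | h L => exact congrArg Vertex.mk (one_smul _ L)
  mul_smul g h v := by
    induction v using Quotient.inductionOn with
    | h L => exact congrArg Vertex.mk (mul_smul g h L)

theorem Vertex.smul_mk (g : GL (Fin 2) K) (L : Lattice O K) :
    g • Vertex.mk L = Vertex.mk (g • L) := rfl

theorem Vertex.scalar_smul (u : Kˣ) (v : Vertex O K) :
    Matrix.GeneralLinearGroup.scalar (Fin 2) u • v = v := by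
  induction v using Quotient.inductionOn with
  | h L =>
    refine Vertex.mk_eq_mk.2 ⟨u⁻¹, ?_⟩
    rw [eq_inv_smul_iff]
    ext x
    rw [Lattice.mem_smul]
    have : ∀ y : Fin 2 → K, (Matrix.GeneralLinearGroup.scalar (Fin 2) u :
        Matrix (Fin 2) (Fin 2) K).mulVec y = u • y := fun y => by
      ext i; simp [Matrix.GeneralLinearGroup.coe_scalar, Units.smul_def, Matrix.mulVec_diagonal]
    simp only [this]
    rfl

/-- The action of `PGL₂(K)` on the vertices of the tree. -/
instance Vertex.mulAction : MulAction PGL(2, K) (Vertex O K) :=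
  Matrix.ProjGenLinGroup.mulActionOfGL Vertex.scalar_smul

theorem Vertex.pgl_smul (g : GL (Fin 2) K) (v : Vertex O K) :
    Matrix.ProjGenLinGroup.mk g • v = g • v := rfl

/-- Two vertices are adjacent if they are represented by lattices with `ϖ L ⊊ L' ⊊ L`, where `ϖ`
is a uniformizer of `O`. -/
def Adj (x y : Vertex O K) : Prop :=
  ∃ L L' : Lattice O K, Vertex.mk L = x ∧ Vertex.mk L' = y ∧
    ∃ ϖ : O, Irreducible ϖ ∧ ϖ • L.1 < L'.1 ∧ L'.1 < L.1

theorem Adj.smul {x y : Vertex O K} (h : Adj x y) (g : PGL(2, K)) : Adj (g • x) (g • y) := by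
  induction g using Matrix.ProjGenLinGroup.induction_on with
  | mk g =>
    obtain ⟨L, L', rfl, rfl, ϖ, hϖ, h1, h2⟩ := h
    have inj : Function.Injective
        ((Matrix.toLin' (g : Matrix (Fin 2) (Fin 2) K)).restrictScalars O) := by
      intro a b hab
      exact Matrix.mulVec_injective_of_isUnit g.isUnit hab
    refine ⟨g • L, g • L', rfl, rfl, ϖ, hϖ, ?_, ?_⟩
    · have h3 := Submodule.map_strictMono_of_injective inj h1
      refine lt_of_eq_of_lt ?_ h3
      ext x
      constructor
      · rintro ⟨_, ⟨y, hy, rfl⟩, rfl⟩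
        exact ⟨ϖ • y, ⟨y, hy, rfl⟩, by simp⟩
      · rintro ⟨_, ⟨y, hy, rfl⟩, rfl⟩
        exact ⟨_, ⟨y, hy, rfl⟩, by simp⟩
    · exact Submodule.map_strictMono_of_injective inj h2

theorem Adj.symm [IsDomain O] [IsFractionRing O K] {x y : Vertex O K} (h : Adj x y) :
    Adj y x := by
  obtain ⟨L, L', rfl, rfl, ϖ, hϖ, h1, h2⟩ := h
  have h0 : algebraMap O K ϖ ≠ 0 := by
    simpa using hϖ.ne_zero
  have hsm : ∀ y : Fin 2 → K, Units.mk0 _ h0 • y = ϖ • y := fun y => by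
    rw [Units.smul_def, Units.val_mk0, algebraMap_smul]
  have hs : ∀ N : Submodule O (Fin 2 → K), Units.mk0 _ h0 • N = ϖ • N := fun N => by
    ext x
    constructor
    · rintro ⟨y, hy, rfl⟩
      exact ⟨y, hy, (hsm y).symm⟩
    · rintro ⟨y, hy, rfl⟩
      exact ⟨y, hy, hsm y⟩
  have := L.2
  let L'' : Lattice O K := ⟨Units.mk0 _ h0 • L.1, inferInstance⟩
  have hL'' : L''.1 = ϖ • L.1 := hs L.1
  refine ⟨L', L'', rfl, ?_, ϖ, hϖ, ?_, ?_⟩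
  · exact (Vertex.mk_eq_mk.2 ⟨Units.mk0 _ h0, rfl⟩).symm
  · rw [hL'', ← hs, ← hs]
    refine lt_of_le_not_ge ?_ fun hle => h2.not_ge ?_
    · rintro _ ⟨y, hy, rfl⟩
      exact ⟨y, h2.le hy, rfl⟩
    · intro y hy
      obtain ⟨z, hz, hzy⟩ := hle ⟨y, hy, rfl⟩
      have hzy' : Units.mk0 _ h0 • z = Units.mk0 _ h0 • y := hzy
      rwa [← smul_left_cancel _ hzy']
  · rw [hL'']
    exact h1

variable (O K) in
/-- The oriented edges of the tree: ordered pairs (origin, terminus) of adjacent vertices. -/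
abbrev Edge : Type _ := {e : Vertex O K × Vertex O K // Adj e.1 e.2}

instance Edge.mulAction : MulAction PGL(2, K) (Edge O K) where
  smul g e := ⟨(g • e.1.1, g • e.1.2), e.2.smul g⟩
  one_smul e := Subtype.ext (Prod.ext (one_smul _ e.1.1) (one_smul _ e.1.2))
  mul_smul g h e := Subtype.ext (Prod.ext (mul_smul g h e.1.1) (mul_smul g h e.1.2))

variable (O K) in
/-- The Bruhat-Tits tree of `SL₂(K)`; all vertices and edges have weight `1`. -/
def tree [IsDomain O] [IsFractionRing O K] : WeightedGraph (Vertex O K) (Edge O K) where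
  o e := e.1.1
  t e := e.1.2
  inv e := ⟨(e.1.2, e.1.1), e.2.symm⟩
  inv_inv _ := rfl
  t_inv _ := rfl
  wV _ := 1
  wE _ := 1
  wE_inv _ := rfl

end BruhatTits

/-! ### Quaternion algebras over `𝔽_q(T)` -/

/-- `B` is a quaternion algebra over the field `F`: a central simple algebra of dimension `4`. -/
class IsQuaternionAlgebra (F B : Type*) [Field F] [Ring B] [Algebra F B] : Prop extends
    Algebra.IsCentral F B, IsSimpleRing B where
  finrank_eq_four : Module.finrank F B = 4

open scoped Classical in
/-- `B` is definite: it is ramified at the place `∞` of `F = k(T)`, i.e. `F_∞ ⊗ B` is a division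
algebra. -/
def IsDefinite (k B : Type*) [Field k] [Ring B] [Algebra (RatFunc k) B] : Prop :=
  ∀ x : RatFunc.CompletionAtInfty k ⊗[RatFunc k] B, x ≠ 0 → IsUnit x

/-- An `A`-order in the `F`-algebra `B`: a subring containing `A` that is a finitely generated
`A`-module and spans `B` over `F`. -/
def IsOrderIn {A : Type*} (F : Type*) {B : Type*} [CommRing A] [Field F] [Algebra A F] [Ring B]
    [Algebra F B] [Algebra A B] [IsScalarTower A F B] (M : Subalgebra A B) : Prop :=
  Submodule.IsLattice F (Subalgebra.toSubmodule M)

/-- A maximal `A`-order in the `F`-algebra `B`. -/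
def IsMaximalOrder {A : Type*} (F : Type*) {B : Type*} [CommRing A] [Field F] [Algebra A F]
    [Ring B] [Algebra F B] [Algebra A B] [IsScalarTower A F B] (M : Subalgebra A B) : Prop :=
  Maximal (IsOrderIn F) M

/-- The degree `log_q |A / 𝔫|` of a non-zero ideal `𝔫` of `A = k[T]`, where `q = |k|`. -/
def idealDegree {k : Type*} [Field k] (I : Ideal k[X]) : ℕ :=
  Nat.log (Nat.card k) (Nat.card (k[X] ⧸ I))

section Gamma

variable {k : Type*} [Field k] (𝔭 : HeightOneSpectrum k[X])

/-- The ring `A[𝔭⁻¹] ⊆ F` of elements that are integral at all primes of `A` except `𝔭`. -/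
abbrev awayFrom : Subalgebra k[X] (RatFunc k) := Set.integer {𝔭} (RatFunc k)

/-- The completion `F_𝔭`. -/
abbrev localField : Type _ := 𝔭.adicCompletion (RatFunc k)

/-- The ring of integers of `F_𝔭`. -/
abbrev localIntegers : Type _ := 𝔭.adicCompletionIntegers (RatFunc k)

variable {B : Type*} [Ring B] [Algebra k[X] B] (M : Subalgebra k[X] B)

/-- The ring `M ⊗ A[𝔭⁻¹]`. -/
abbrev OrderAway : Type _ := M ⊗[k[X]] awayFrom 𝔭

/-- The image of `A[𝔭⁻¹]ˣ` in `(M ⊗ A[𝔭⁻¹])ˣ`. -/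
def scalarUnits : Subgroup (OrderAway 𝔭 M)ˣ :=
  (Units.map (Algebra.TensorProduct.includeRight :
    awayFrom 𝔭 →ₐ[k[X]] OrderAway 𝔭 M).toMonoidHom).range

theorem scalarUnits_comm {u : (OrderAway 𝔭 M)ˣ} (hu : u ∈ scalarUnits 𝔭 M)
    (g : (OrderAway 𝔭 M)ˣ) : g * u = u * g := by
  obtain ⟨s, rfl⟩ := hu
  apply Units.ext
  change (g : OrderAway 𝔭 M) * ((1 : M) ⊗ₜ (s : awayFrom 𝔭)) =
    ((1 : M) ⊗ₜ (s : awayFrom 𝔭)) * (g : OrderAway 𝔭 M)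
  induction (g : OrderAway 𝔭 M) using TensorProduct.induction_on with
  | zero => simp
  | tmul m t => simp [Algebra.TensorProduct.tmul_mul_tmul, mul_comm]
  | add a b ha hb => rw [add_mul, mul_add, ha, hb]

instance scalarUnits_normal : (scalarUnits 𝔭 M).Normal where
  conj_mem u hu g := by rwa [scalarUnits_comm 𝔭 M hu g, mul_inv_cancel_right]

variable [Algebra (RatFunc k) B] [IsScalarTower k[X] (RatFunc k) B]

/-- The natural homomorphism `M ⊗ A[𝔭⁻¹] → B`, `m ⊗ s ↦ s m`. -/
def OrderAway.toAlg : OrderAway 𝔭 M →ₐ[k[X]] B :=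
  Algebra.TensorProduct.lift M.val
    ((IsScalarTower.toAlgHom k[X] (RatFunc k) B).comp (awayFrom 𝔭).val)
    (fun m s => (Algebra.commutes (s : RatFunc k) (m : B)).symm)

variable (φ : localField 𝔭 ⊗[RatFunc k] B ≃ₐ[localField 𝔭]
  Matrix (Fin 2) (Fin 2) (localField 𝔭))

/-- The group `Γ₀ = (M ⊗ A[𝔭⁻¹])ˣ / A[𝔭⁻¹]ˣ`. The isomorphism `φ`, through which `Γ₀` acts on the
tree, is recorded in the type. -/
@[nolint unusedArguments]
def Gamma0 (_φ : localField 𝔭 ⊗[RatFunc k] B ≃ₐ[localField 𝔭]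
    Matrix (Fin 2) (Fin 2) (localField 𝔭)) : Type _ :=
  (OrderAway 𝔭 M)ˣ ⧸ scalarUnits 𝔭 M

instance : Group (Gamma0 𝔭 M φ) := inferInstanceAs (Group ((OrderAway 𝔭 M)ˣ ⧸ scalarUnits 𝔭 M))

/-- The homomorphism `(M ⊗ A[𝔭⁻¹])ˣ → GL₂(F_𝔭)` given by `M ⊗ A[𝔭⁻¹] → B → F_𝔭 ⊗ B ≅ M₂(F_𝔭)`. -/
def unitsToGL : (OrderAway 𝔭 M)ˣ →* GL (Fin 2) (localField 𝔭) :=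
  Units.map ((φ : localField 𝔭 ⊗[RatFunc k] B →* Matrix (Fin 2) (Fin 2) (localField 𝔭)).comp
    ((Algebra.TensorProduct.includeRight :
      B →ₐ[RatFunc k] localField 𝔭 ⊗[RatFunc k] B).toMonoidHom.comp
        (OrderAway.toAlg 𝔭 M).toMonoidHom))

/-- The homomorphism `Γ₀ → PGL₂(F_𝔭)`. -/
def Gamma0.toPGL : Gamma0 𝔭 M φ →* PGL(2, localField 𝔭) :=
  QuotientGroup.lift (scalarUnits 𝔭 M) (Matrix.ProjGenLinGroup.mk.comp (unitsToGL 𝔭 M φ)) (by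
    rintro _ ⟨s, rfl⟩
    have h : unitsToGL 𝔭 M φ (Units.map (Algebra.TensorProduct.includeRight :
        awayFrom 𝔭 →ₐ[k[X]] OrderAway 𝔭 M).toMonoidHom s) =
          Matrix.GeneralLinearGroup.scalar (Fin 2) (Units.map
            ((algebraMap (RatFunc k) (localField 𝔭)).comp
              (algebraMap (awayFrom 𝔭) (RatFunc k))).toMonoidHom s) := by
      apply Units.ext
      change φ (1 ⊗ₜ (OrderAway.toAlg 𝔭 M ((1 : M) ⊗ₜ (s : awayFrom 𝔭)))) =
        Matrix.scalar (Fin 2) (algebraMap (RatFunc k) (localField 𝔭) ((s : awayFrom 𝔭) : RatFunc k))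
      have h1 : OrderAway.toAlg 𝔭 M ((1 : M) ⊗ₜ (s : awayFrom 𝔭)) =
          ((s : awayFrom 𝔭) : RatFunc k) • (1 : B) := by
        refine (Algebra.TensorProduct.lift_tmul _ _ _ _ _).trans ?_
        rw [map_one, one_mul, ← Algebra.algebraMap_eq_smul_one]
        rfl
      have h2 : (1 : localField 𝔭) ⊗ₜ[RatFunc k] (((s : awayFrom 𝔭) : RatFunc k) • (1 : B)) =
          algebraMap (localField 𝔭) (localField 𝔭 ⊗[RatFunc k] B)
            (algebraMap (RatFunc k) (localField 𝔭) ((s : awayFrom 𝔭) : RatFunc k)) := by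
        rw [TensorProduct.tmul_smul, TensorProduct.smul_tmul', Algebra.TensorProduct.algebraMap_apply,
          Algebra.smul_def, mul_one]
        rfl
      rw [h1, h2, AlgEquiv.commutes]
      rfl
    rw [MonoidHom.mem_ker, MonoidHom.comp_apply, h, Matrix.ProjGenLinGroup.mk_scalar])

instance : MulAction (Gamma0 𝔭 M φ) (BruhatTits.Vertex (localIntegers 𝔭) (localField 𝔭)) :=
  MulAction.compHom _ (Gamma0.toPGL 𝔭 M φ)

instance : MulAction (Gamma0 𝔭 M φ) (BruhatTits.Edge (localIntegers 𝔭) (localField 𝔭)) :=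
  MulAction.compHom _ (Gamma0.toPGL 𝔭 M φ)

theorem Gamma0.isAction :
    (BruhatTits.tree (localIntegers 𝔭) (localField 𝔭)).IsAction (Gamma0 𝔭 M φ) where
  smul_o _ _ := rfl
  smul_inv _ _ := rfl
  wV_smul _ _ := rfl
  wE_smul _ _ := rfl

/-- The weighted graph `G₀ = Γ₀ \ 𝒯`. -/
def graphG0 : WeightedGraph
    (MulAction.orbitRel.Quotient (Gamma0 𝔭 M φ)
      (BruhatTits.Vertex (localIntegers 𝔭) (localField 𝔭)))
    (MulAction.orbitRel.Quotient (Gamma0 𝔭 M φ)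
      (BruhatTits.Edge (localIntegers 𝔭) (localField 𝔭))) :=
  (BruhatTits.tree (localIntegers 𝔭) (localField 𝔭)).quotient (Gamma0 𝔭 M φ)
    (Gamma0.isAction 𝔭 M φ)

end Gamma

end

/-!
The vertex `v` is the class of a lattice `L ⊆ F_𝔭²`. A generator of `𝔭` is a unit of `A[𝔭⁻¹]`, so
every element of the stabilizer `Γ_v` is represented by a unit `u` of `M ⊗ A[𝔭⁻¹]` with `uL = L`
(`Gamma0.exists_lift_of_smul_eq`). Let `u` be such a unit outside `F`, and let `X² - tX + n` be the
characteristic polynomial of the matrix of `u`. Its coefficients lie in `F` because `1, u, u²` are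
linearly dependent over `F_𝔭`, hence over `F`. They are integral away from `𝔭` because `M` is
integral over `A`, and at `𝔭` because `uL = L`. So `t ∈ A` and `n ∈ Aˣ = kˣ`. Since `F_∞ ⊗ B` is a
division algebra, the polynomial has no root in `F_∞`. If `t` were not constant, Hensel's lemma
would give a root, so `t ∈ k`, and `X² - tX + n` is irreducible over `k`
(`exists_const_trace_det`).

Hence `k[u]` is a field with `q²` elements, and `1` and `a + u`, for `a ∈ k`, give `q + 1` distinct
elements of `Γ_v`. As `Γ_v` has order `q + 1`, these are all (`Gamma0.exists_lift_mem`). Therefore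
an `O`-module stable under one non-trivial element of `Γ_v` is stable under all of `Γ_v`, and an
edge ending in `v` has weight `q + 1` or `1` according as `u` fixes its origin or not
(`card_stabilizer_edge`).

The neighbours of `v` are the lines in the plane `L / ϖL` over the residue field `A / 𝔭`, and those
fixed by `u` are its eigenlines. The field `A / 𝔭` has `q ^ deg 𝔭` elements. So for even degree
`X² - tX + n` has two distinct roots in it and there are two eigenlines
(`BruhatTits.Lattice.exists_two_invariant_sublattices`), while for odd degree it has no root and
there are none (`BruhatTits.Lattice.no_invariant_sublattice`). The two edges for even degree are
not equivalent, since `Γ_v` fixes both.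
-/

noncomputable section

/-! ### Quadratic equations over complete fields and finite fields -/

theorem Valued.nonarchimedeanAddGroup (R : Type*) {Γ₀ : Type*} [Ring R]
    [LinearOrderedCommGroupWithZero Γ₀] [Valued R Γ₀] : NonarchimedeanAddGroup R where
  is_nonarchimedean U hU := by
    obtain ⟨γ, hγ⟩ := (Valued.is_topological_valuation U).1 hU
    exact ⟨⟨Valued.v.restrict.ltAddSubgroup γ, Valued.isOpen_ball R _⟩, hγ⟩

open Filter Topology in
/-- Hensel's lemma for `Y² - Y + c`: the iteration `y ↦ c + y²` started at `0` converges, since it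
is a contraction on `{y | v y ≤ v c}`. -/
theorem Valued.exists_sq_sub_self_add_eq_zero {K : Type*} [Field K]
    [Valued K (WithZero (Multiplicative ℤ))] [CompleteSpace K] [T2Space K] {c : K}
    (hc : Valued.v c < 1) : ∃ y : K, y ^ 2 - y + c = 0 := by
  let f : ℕ → K := fun n => Nat.rec 0 (fun _ y => c + y ^ 2) n
  have hf : ∀ n, f (n + 1) = c + f n ^ 2 := fun n => rfl
  have hle : ∀ n, Valued.v (f n) ≤ Valued.v c := by
    intro n
    induction n with
    | zero => simp [f]
    | succ n ih =>
      rw [hf]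
      refine (Valuation.map_add _ _ _).trans (max_le le_rfl ?_)
      rw [map_pow, sq]
      exact (mul_le_mul' ih (ih.trans hc.le)).trans (by rw [mul_one])
  have hd : ∀ n, Valued.v (f (n + 1) - f n) ≤ Valued.v c ^ (n + 1) := by
    intro n
    induction n with
    | zero => simp [f]
    | succ n ih =>
      have : f (n + 1 + 1) - f (n + 1) = (f (n + 1) - f n) * (f (n + 1) + f n) := by
        rw [hf (n + 1), hf n]; ring
      rw [this, map_mul, pow_succ (Valued.v c) (n + 1)]
      exact mul_le_mul' ih ((Valuation.map_add _ _ _).trans (max_le (hle (n + 1)) (hle n)))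
  have hlim : Tendsto (fun n => f (n + 1) - f n) atTop (𝓝 0) := by
    rw [(Valued.hasBasis_nhds_zero K _).tendsto_right_iff]
    intro γ _
    obtain ⟨m, hm⟩ := exists_pow_lt₀ hc (Units.map
      (MonoidWithZeroHom.ValueGroup₀.embedding (f := (.ofClass (Valued.v : Valuation K _)))) γ)
    filter_upwards [eventually_ge_atTop m] with n hn
    rw [Valuation.restrict_lt_iff_lt_embedding]
    refine ((hd n).trans ?_).trans_lt hm
    exact pow_le_pow_right_of_le_one' hc.le (hn.trans n.le_succ)
  have := Valued.nonarchimedeanAddGroup K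
  obtain ⟨y, hy⟩ := cauchySeq_tendsto_of_complete
    (NonarchimedeanAddGroup.cauchySeq_of_tendsto_sub_nhds_zero hlim)
  refine ⟨y, ?_⟩
  have h1 : Tendsto (fun n => f (n + 1)) atTop (𝓝 (c + y ^ 2)) :=
    tendsto_const_nhds.add (hy.pow 2)
  have h2 := tendsto_nhds_unique h1 (hy.comp (tendsto_add_atTop_nat 1))
  linear_combination h2

section FiniteField

variable {k κ : Type*} [Field k] [Field κ]

theorem irreducible_X_sq_sub {t n : k} (h : ∀ r : k, r ^ 2 - t * r + n ≠ 0) :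
    Irreducible (X ^ 2 - C t * X + C n : k[X]) := by
  have hm : (X ^ 2 - C t * X + C n : k[X]).natDegree = 2 := by compute_degree!
  have hm' : (X ^ 2 - C t * X + C n : k[X]).Monic := by monicity!
  rw [hm'.irreducible_iff_roots_eq_zero_of_degree_le_three (by omega) (by omega)]
  refine Multiset.eq_zero_of_forall_notMem fun r hr => h r ?_
  simpa using (mem_roots'.1 hr).2

variable [Finite k]

/-- An irreducible quadratic polynomial over the field with `q` elements has two distinct roots in
the field with `q ^ d` elements, `d` even: it divides `X ^ q ^ d - X`, and finite fields are
perfect. -/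
theorem exists_two_roots_of_even (i : k →+* κ) {d : ℕ}
    (hκ : Nat.card κ = Nat.card k ^ d) (hd : Even d) {t n : k}
    (h : ∀ r : k, r ^ 2 - t * r + n ≠ 0) : ∃ a b : κ, a ≠ b ∧ a + b = i t ∧ a * b = i n := by
  have : Finite κ := Nat.finite_of_card_ne_zero (by rw [hκ]; exact pow_ne_zero _ Nat.card_pos.ne')
  have := Fintype.ofFinite κ
  have hirr := irreducible_X_sq_sub h
  set f : k[X] := X ^ 2 - C t * X + C n with hf
  have hm : f.natDegree = 2 := by rw [hf]; compute_degree!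
  let := i.toAlgebra
  have hdvd := hirr.natDegree_dvd_iff_dvd_X_pow_card_pow_sub_X (n := d)
  rw [hm] at hdvd
  have h1 := map_dvd (mapRingHom i) (hdvd.1 hd.two_dvd)
  have h2 : mapRingHom i (X ^ Nat.card k ^ d - X) = X ^ Fintype.card κ - X := by
    rw [← Nat.card_eq_fintype_card, hκ]; simp
  rw [h2] at h1
  have hs : (mapRingHom i f).Splits :=
    Splits.of_dvd (splits_iff_card_roots.2 (by
        rw [FiniteField.roots_X_pow_card_sub_X,
          FiniteField.X_pow_card_sub_X_natDegree_eq κ Fintype.one_lt_card]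
        rfl))
      (FiniteField.X_pow_card_sub_X_ne_zero κ Fintype.one_lt_card) h1
  obtain ⟨a, ha⟩ := hs.exists_eval_eq_zero (by
    rw [coe_mapRingHom, degree_map, degree_eq_natDegree hirr.ne_zero, hm]; norm_num)
  have ha' : a ^ 2 - i t * a + i n = 0 := by simpa [hf] using ha
  refine ⟨a, i t - a, ?_, by ring, by linear_combination -ha'⟩
  intro hab
  have hsep := PerfectField.separable_of_irreducible hirr
  have h3 := hsep.aeval_derivative_ne_zero (x := a) (by
    rw [aeval_def, eval₂_eq_eval_map]; exact ha)
  apply h3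
  have h4 : (algebraMap k κ) t = i t := rfl
  simp [hf, h4]
  linear_combination hab

/-- An irreducible quadratic polynomial over the field with `q` elements has no root in the field
with `q ^ d` elements, `d` odd. -/
theorem no_root_of_odd (i : k →+* κ) {d : ℕ}
    (hκ : Nat.card κ = Nat.card k ^ d) (hd : ¬ Even d) {t n : k}
    (h : ∀ r : k, r ^ 2 - t * r + n ≠ 0) (c : κ) : c ^ 2 - i t * c + i n ≠ 0 := by
  have : Finite κ := Nat.finite_of_card_ne_zero (by rw [hκ]; exact pow_ne_zero _ Nat.card_pos.ne')
  intro hc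
  have hirr := irreducible_X_sq_sub h
  set f : k[X] := X ^ 2 - C t * X + C n with hf
  have hm : f.natDegree = 2 := by rw [hf]; compute_degree!
  let := i.toAlgebra
  have hfin : Module.finrank k κ = d := by
    have := Module.natCard_eq_pow_finrank (K := k) (V := κ)
    rw [hκ] at this
    exact (Nat.pow_right_injective Finite.one_lt_card this).symm
  have hroot : aeval c f = 0 := by
    have h4 : ∀ t, (algebraMap k κ) t = i t := fun _ => rfl
    simp [hf, h4, hc]
  have h5 := minpoly.degree_dvd (IsIntegral.of_finite k c)
  have hmon : f.Monic := by rw [hf]; monicity!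
  rw [← minpoly.eq_of_irreducible_of_monic hirr hroot hmon, hm, hfin] at h5
  exact hd (even_iff_two_dvd.2 h5)

end FiniteField

/-! ### Invariant lines of a `2 × 2` matrix -/

section Lines

variable {κ : Type*} [Field κ] (U : Matrix (Fin 2) (Fin 2) κ)

theorem Matrix.det_sub_scalar_fin_two (c : κ) :
    (U - Matrix.scalar (Fin 2) c).det = c ^ 2 - U.trace * c + U.det := by
  simp [Matrix.det_fin_two, Matrix.trace_fin_two]
  ring

theorem Matrix.exists_mulVec_eq_smul_iff (c : κ) :
    (∃ w ≠ 0, U.mulVec w = c • w) ↔ c ^ 2 - U.trace * c + U.det = 0 := by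
  rw [← Matrix.det_sub_scalar_fin_two, ← Matrix.exists_mulVec_eq_zero_iff]
  have h : ∀ w : Fin 2 → κ, (Matrix.scalar (Fin 2) c).mulVec w = c • w := fun w => by
    ext i; simp [Matrix.mulVec_diagonal]
  simp only [Matrix.sub_mulVec, h, sub_eq_zero]

theorem exists_eq_span_singleton {W : Submodule κ (Fin 2 → κ)} (h0 : ⊥ < W) (h1 : W < ⊤) :
    ∃ w ≠ 0, W = Submodule.span κ {w} := by
  obtain ⟨w, hw, hw0⟩ := (Submodule.ne_bot_iff W).1 h0.ne'
  refine ⟨w, hw0, ?_⟩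
  have h2 : Module.finrank κ W < 2 := by
    simpa using Submodule.finrank_lt h1.ne
  refine (Submodule.eq_of_le_of_finrank_le ?_ ?_).symm
  · rwa [Submodule.span_singleton_le_iff_mem]
  · rw [finrank_span_singleton hw0]; omega

theorem exists_mulVec_eq_smul_of_invariant {W : Submodule κ (Fin 2 → κ)} (h0 : ⊥ < W) (h1 : W < ⊤)
    (h : ∀ w ∈ W, U.mulVec w ∈ W) :
    ∃ w ≠ 0, W = Submodule.span κ {w} ∧ ∃ c : κ, U.mulVec w = c • w := by
  obtain ⟨w, hw0, rfl⟩ := exists_eq_span_singleton h0 h1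
  obtain ⟨c, hc⟩ := Submodule.mem_span_singleton.1 (h w (Submodule.mem_span_singleton_self w))
  exact ⟨w, hw0, rfl, c, hc.symm⟩

theorem no_invariant_line (hU : ∀ c, c ^ 2 - U.trace * c + U.det ≠ 0)
    {W : Submodule κ (Fin 2 → κ)} (h0 : ⊥ < W) (h1 : W < ⊤) : ¬ ∀ w ∈ W, U.mulVec w ∈ W := by
  intro h
  obtain ⟨w, hw0, -, c, hc⟩ := exists_mulVec_eq_smul_of_invariant U h0 h1 h
  exact hU c ((Matrix.exists_mulVec_eq_smul_iff U c).1 ⟨w, hw0, hc⟩)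

/-- A `2 × 2` matrix with two distinct eigenvalues has exactly two invariant lines. -/
theorem exists_two_invariant_lines {a b : κ} (hab : a ≠ b) (ht : a + b = U.trace)
    (hn : a * b = U.det) :
    ∃ W₁ W₂ : Submodule κ (Fin 2 → κ), W₁ ≠ W₂ ∧
      ∀ W, (⊥ < W ∧ W < ⊤ ∧ ∀ w ∈ W, U.mulVec w ∈ W) ↔ (W = W₁ ∨ W = W₂) := by
  obtain ⟨x, hx0, hx⟩ := (Matrix.exists_mulVec_eq_smul_iff U a).2 (by rw [← ht, ← hn]; ring)
  obtain ⟨y, hy0, hy⟩ := (Matrix.exists_mulVec_eq_smul_iff U b).2 (by rw [← ht, ← hn]; ring)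
  have hli : ∀ c d : κ, c • x + d • y = 0 → c = 0 ∧ d = 0 := by
    intro c d h
    have h' := congrArg U.mulVec h
    rw [Matrix.mulVec_add, Matrix.mulVec_smul, Matrix.mulVec_smul, hx, hy,
      Matrix.mulVec_zero] at h'
    have h1 : ((b - a) * d) • y = 0 := by
      have h2 := congrArg (a • ·) h
      simp only [smul_add, smul_zero] at h2
      rw [← sub_eq_zero.2 (h'.trans h2.symm)]
      module
    have hd : d = 0 := by
      simpa [hy0, sub_eq_zero, hab.symm] using h1
    subst hd
    exact ⟨by simpa [hx0] using h, rfl⟩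
  have hli2 : LinearIndependent κ ![x, y] := LinearIndependent.pair_iff.2 hli
  have hne : y ∉ Submodule.span κ {x} := by
    intro h
    obtain ⟨c, hc⟩ := Submodule.mem_span_singleton.1 h
    have := (hli c (-1) (by rw [hc]; simp)).2
    simp at this
  have hne' : x ∉ Submodule.span κ {y} := by
    intro h
    obtain ⟨c, hc⟩ := Submodule.mem_span_singleton.1 h
    have := (hli (-1) c (by rw [hc]; simp)).1
    simp at this
  have hst : ∀ {z : Fin 2 → κ} {c : κ}, U.mulVec z = c • z →
      ∀ w ∈ Submodule.span κ {z}, U.mulVec w ∈ Submodule.span κ {z} := by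
    intro z c hz w hw
    obtain ⟨e, rfl⟩ := Submodule.mem_span_singleton.1 hw
    rw [Matrix.mulVec_smul, hz]
    exact Submodule.smul_mem _ _ (Submodule.smul_mem _ _ (Submodule.mem_span_singleton_self z))
  refine ⟨Submodule.span κ {x}, Submodule.span κ {y}, ?_, fun W => ⟨?_, ?_⟩⟩
  · intro h
    exact hne (h ▸ Submodule.mem_span_singleton_self y)
  · rintro ⟨h0, h1, h⟩
    obtain ⟨w, hw0, rfl, c, hc⟩ := exists_mulVec_eq_smul_of_invariant U h0 h1 h
    have hspan : w ∈ Submodule.span κ (Set.range ![x, y]) := by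
      rw [hli2.span_eq_top_of_card_eq_finrank (by simp)]; trivial
    rw [Matrix.range_cons, Matrix.range_cons, Matrix.range_empty, Set.union_empty,
      Set.singleton_union, Submodule.mem_span_pair] at hspan
    obtain ⟨r, s, rfl⟩ := hspan
    rw [Matrix.mulVec_add, Matrix.mulVec_smul, Matrix.mulVec_smul, hx, hy] at hc
    obtain ⟨h2, h3⟩ := hli (r * (a - c)) (s * (b - c)) (by
      rw [← sub_eq_zero.2 hc]
      module)
    rcases mul_eq_zero.1 h2 with rfl | h2
    · right
      have hs : s ≠ 0 := by rintro rfl; simp at hw0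
      rw [zero_smul, zero_add]
      exact Submodule.span_singleton_smul_eq (IsUnit.mk0 s hs) y
    · left
      have hs : s = 0 := by
        refine (mul_eq_zero.1 h3).resolve_right fun h4 => hab ?_
        rw [sub_eq_zero.1 h2, sub_eq_zero.1 h4]
      subst hs
      have hr : r ≠ 0 := by rintro rfl; simp at hw0
      rw [zero_smul, add_zero]
      exact Submodule.span_singleton_smul_eq (IsUnit.mk0 r hr) x
  · rintro (rfl | rfl)
    · exact ⟨bot_lt_iff_ne_bot.2 (by simpa using hx0),
        lt_top_iff_ne_top.2 fun h => hne (h ▸ trivial),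
        hst hx⟩
    · exact ⟨bot_lt_iff_ne_bot.2 (by simpa using hy0),
        lt_top_iff_ne_top.2 fun h => hne' (h ▸ trivial), hst hy⟩

end Lines

/-! ### Lattices between `ϖL` and `L` -/

namespace BruhatTits

open IsLocalRing

variable {O K : Type*} [CommRing O] [IsDomain O] [IsDiscreteValuationRing O] [Field K]
  [Algebra O K] [IsFractionRing O K]

/-- The embedding `O² → K²`, `y ↦ h y`, whose image is the lattice `h O²`. -/
def frame (h : GL (Fin 2) K) : (Fin 2 → O) →ₗ[O] (Fin 2 → K) :=
  ((Matrix.toLin' (h : Matrix (Fin 2) (Fin 2) K)).restrictScalars O) ∘ₗ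
    (Algebra.linearMap O K).compLeft (Fin 2)

omit [IsDomain O] [IsDiscreteValuationRing O] [IsFractionRing O K] in
theorem frame_apply (h : GL (Fin 2) K) (y : Fin 2 → O) :
    frame h y = (h : Matrix (Fin 2) (Fin 2) K).mulVec (fun i => algebraMap O K (y i)) := rfl

omit [IsDomain O] [IsDiscreteValuationRing O] in
theorem frame_injective (h : GL (Fin 2) K) : Function.Injective (frame (O := O) h) := by
  intro x y hxy
  have := Matrix.mulVec_injective_of_isUnit h.isUnit hxy
  funext i
  exact IsFractionRing.injective O K (congrFun this i)

/-- Reduction of vectors modulo the maximal ideal. -/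
def reduce : (Fin 2 → O) →ₗ[O] (Fin 2 → ResidueField O) :=
  (Algebra.linearMap O (ResidueField O)).compLeft (Fin 2)

theorem reduce_apply (y : Fin 2 → O) (i : Fin 2) : reduce y i = residue O (y i) := rfl

theorem reduce_surjective : Function.Surjective (reduce (O := O)) := by
  intro w
  choose y hy using fun i => residue_surjective (w i)
  exact ⟨y, funext hy⟩

theorem reduce_eq_zero_iff {ϖ : O} (hϖ : Irreducible ϖ) (y : Fin 2 → O) :
    reduce y = 0 ↔ ∃ z, y = ϖ • z := by
  constructor
  · intro h
    have : ∀ i, ∃ z, y i = ϖ * z := fun i => by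
      have h1 := congrFun h i
      rw [reduce_apply, Pi.zero_apply, residue_eq_zero_iff, hϖ.maximalIdeal_eq,
        Ideal.mem_span_singleton] at h1
      exact h1
    choose z hz using this
    exact ⟨z, funext hz⟩
  · rintro ⟨z, rfl⟩
    rw [map_smul]
    funext i
    have : residue O ϖ = 0 := by
      rw [residue_eq_zero_iff, hϖ.maximalIdeal_eq]; exact Ideal.mem_span_singleton_self ϖ
    rw [Pi.smul_apply, Algebra.smul_def]
    change residue O ϖ * _ = 0
    rw [this, zero_mul]

/-- The preimage in the lattice `h O²` of a subspace of its reduction. -/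
def ofSubspace (h : GL (Fin 2) K) (W : Submodule (ResidueField O) (Fin 2 → ResidueField O)) :
    Submodule O (Fin 2 → K) :=
  ((W.restrictScalars O).comap reduce).map (frame h)

omit [IsFractionRing O K] in
theorem mem_ofSubspace {h : GL (Fin 2) K}
    {W : Submodule (ResidueField O) (Fin 2 → ResidueField O)} {x : Fin 2 → K} :
    x ∈ ofSubspace h W ↔ ∃ y, reduce y ∈ W ∧ frame h y = x := Iff.rfl

theorem frame_mem_ofSubspace {h : GL (Fin 2) K}
    {W : Submodule (ResidueField O) (Fin 2 → ResidueField O)} {y : Fin 2 → O} :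
    frame h y ∈ ofSubspace h W ↔ reduce y ∈ W := by
  rw [mem_ofSubspace]
  constructor
  · rintro ⟨z, hz, hzy⟩
    rwa [← frame_injective h hzy]
  · exact fun hy => ⟨y, hy, rfl⟩

theorem ofSubspace_le_iff {h : GL (Fin 2) K}
    {W W' : Submodule (ResidueField O) (Fin 2 → ResidueField O)} :
    ofSubspace h W ≤ ofSubspace h W' ↔ W ≤ W' := by
  constructor
  · intro hle w hw
    obtain ⟨y, rfl⟩ := reduce_surjective w
    exact frame_mem_ofSubspace.1 (hle (frame_mem_ofSubspace.2 hw))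
  · rintro hle _ ⟨y, hy, rfl⟩
    exact ⟨y, hle hy, rfl⟩

theorem ofSubspace_lt_iff {h : GL (Fin 2) K}
    {W W' : Submodule (ResidueField O) (Fin 2 → ResidueField O)} :
    ofSubspace h W < ofSubspace h W' ↔ W < W' := by
  simp only [lt_iff_le_not_ge, ofSubspace_le_iff]

theorem ofSubspace_injective (h : GL (Fin 2) K) : Function.Injective (ofSubspace (O := O) h) :=
  fun _ _ hW => le_antisymm (ofSubspace_le_iff.1 hW.le) (ofSubspace_le_iff.1 hW.ge)

omit [IsFractionRing O K] in
theorem ofSubspace_top (h : GL (Fin 2) K) :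
    ofSubspace h (⊤ : Submodule (ResidueField O) _) = LinearMap.range (frame h) := by
  ext x
  simp [mem_ofSubspace]

omit [IsFractionRing O K] in
theorem ofSubspace_bot (h : GL (Fin 2) K) {ϖ : O} (hϖ : Irreducible ϖ) :
    ofSubspace h (⊥ : Submodule (ResidueField O) _) = ϖ • LinearMap.range (frame h) := by
  ext x
  rw [mem_ofSubspace, Submodule.mem_smul_pointwise_iff_exists]
  simp only [Submodule.mem_bot, reduce_eq_zero_iff hϖ]
  constructor
  · rintro ⟨_, ⟨z, rfl⟩, rfl⟩
    exact ⟨_, ⟨z, rfl⟩, (map_smul _ _ _).symm⟩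
  · rintro ⟨_, ⟨z, rfl⟩, rfl⟩
    exact ⟨_, ⟨z, rfl⟩, map_smul _ _ _⟩

omit [IsFractionRing O K] in
/-- Every `O`-module between `ϖL` and `L = h O²` is the preimage of a subspace of `L / ϖL`. -/
theorem exists_ofSubspace_eq (h : GL (Fin 2) K) {ϖ : O} (hϖ : Irreducible ϖ)
    {N : Submodule O (Fin 2 → K)} (h1 : ϖ • LinearMap.range (frame h) ≤ N)
    (h2 : N ≤ LinearMap.range (frame h)) : ∃ W, ofSubspace (O := O) h W = N := by
  refine ⟨{ carrier := reduce '' {y | frame h y ∈ N}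
            add_mem' := ?_, zero_mem' := ?_, smul_mem' := ?_ }, ?_⟩
  · rintro _ _ ⟨y, hy, rfl⟩ ⟨z, hz, rfl⟩
    exact ⟨y + z, by simpa using N.add_mem hy hz, map_add _ _ _⟩
  · exact ⟨0, by simp, map_zero _⟩
  · rintro c _ ⟨y, hy, rfl⟩
    obtain ⟨a, rfl⟩ := residue_surjective c
    exact ⟨a • y, by simpa using N.smul_mem a hy, map_smul _ _ _⟩
  · ext x
    constructor
    · rintro ⟨y, ⟨z, hz, hzy⟩, rfl⟩
      have : reduce (y - z) = 0 := by rw [map_sub, hzy, sub_self]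
      obtain ⟨s, hs⟩ := (reduce_eq_zero_iff hϖ _).1 this
      have h3 : frame h y = frame h z + ϖ • frame h s := by
        rw [← map_smul, ← hs, map_sub]; abel
      rw [h3]
      exact N.add_mem hz (h1 (Submodule.smul_mem_pointwise_smul _ _ _ ⟨s, rfl⟩))
    · intro hx
      obtain ⟨y, rfl⟩ := h2 hx
      exact ⟨y, ⟨y, hx, rfl⟩, rfl⟩

/-- Every lattice is the image of `O²` under an element of `GL₂(K)`. -/
theorem Lattice.exists_eq_range_frame (L : Lattice O K) :
    ∃ h : GL (Fin 2) K, L.1 = LinearMap.range (frame (O := O) h) := by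
  have := L.2
  have hfr : Module.finrank O L.1 = 2 := by
    simpa using Submodule.IsLattice.finrank_of_pi K L.1
  let b : Module.Basis (Fin 2) O L.1 := Module.finBasisOfFinrankEq O L.1 hfr
  let b' := b.extendOfIsLattice K
  let h : GL (Fin 2) K := Matrix.GeneralLinearGroup.mkOfDetNeZero
    ((Pi.basisFun K (Fin 2)).toMatrix b')
    ((Pi.basisFun K (Fin 2)).isUnit_det b').ne_zero
  have hfe : ∀ y : Fin 2 → O, frame h y = (∑ i, y i • b i : L.1) := by
    intro y
    rw [frame_apply]
    funext j
    simp [h, b', Matrix.GeneralLinearGroup.mkOfDetNeZero, Matrix.mulVec, dotProduct,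
      Module.Basis.toMatrix_apply, Algebra.smul_def, mul_comm]
  refine ⟨h, ?_⟩
  ext x
  constructor
  · intro hx
    refine ⟨fun i => b.repr ⟨x, hx⟩ i, ?_⟩
    rw [hfe, b.sum_repr]
  · rintro ⟨y, rfl⟩
    rw [hfe]
    exact Subtype.prop _

omit [IsDomain O] [IsDiscreteValuationRing O] [IsFractionRing O K] in
/-- A matrix that maps the lattice `h O²` to itself is given, in the basis `h`, by a matrix with
entries in `O`. -/
theorem exists_matrix_of_mapsTo (h : GL (Fin 2) K) {g : Matrix (Fin 2) (Fin 2) K}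
    (hg : ∀ x ∈ LinearMap.range (frame (O := O) h),
      g.mulVec x ∈ LinearMap.range (frame (O := O) h)) :
    ∃ U : Matrix (Fin 2) (Fin 2) O, g.trace = algebraMap O K U.trace ∧
      g.det = algebraMap O K U.det ∧ ∀ y, g.mulVec (frame h y) = frame h (U.mulVec y) := by
  choose u hu using fun j : Fin 2 => hg (frame h (Pi.single j 1)) ⟨_, rfl⟩
  let U : Matrix (Fin 2) (Fin 2) O := Matrix.of fun i j => u j i
  have key : g * (h : Matrix (Fin 2) (Fin 2) K) =
      (h : Matrix (Fin 2) (Fin 2) K) * U.map (algebraMap O K) := by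
    ext i j
    have h1 := congrFun (hu j) i
    rw [frame_apply, frame_apply, Matrix.mulVec_mulVec] at h1
    have h2 : (fun i => algebraMap O K ((Pi.single j 1 : Fin 2 → O) i)) = Pi.single j 1 := by
      funext i
      by_cases hij : i = j
      · subst hij; simp
      · simp [hij]
    rw [h2, Matrix.mulVec_single_one] at h1
    exact h1.symm
  have key2 : g = (h : Matrix (Fin 2) (Fin 2) K) * U.map (algebraMap O K) *
      (↑h⁻¹ : Matrix (Fin 2) (Fin 2) K) := by
    rw [← key, mul_assoc, ← Units.val_mul, mul_inv_cancel, Units.val_one, mul_one]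
  refine ⟨U, ?_, ?_, fun y => ?_⟩
  · rw [key2, Matrix.trace_units_conj]
    simp [Matrix.trace_fin_two]
  · rw [key2, Matrix.det_units_conj]
    simp [Matrix.det_fin_two]
  · rw [frame_apply, frame_apply, Matrix.mulVec_mulVec, key, ← Matrix.mulVec_mulVec]
    congr 1
    funext i
    simp [Matrix.mulVec, dotProduct]

theorem mapsTo_ofSubspace_iff (h : GL (Fin 2) K) {g : Matrix (Fin 2) (Fin 2) K}
    {U : Matrix (Fin 2) (Fin 2) O} (hU : ∀ y, g.mulVec (frame h y) = frame h (U.mulVec y))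
    (W : Submodule (ResidueField O) (Fin 2 → ResidueField O)) :
    (∀ x ∈ ofSubspace h W, g.mulVec x ∈ ofSubspace h W) ↔
      ∀ w ∈ W, (U.map (residue O)).mulVec w ∈ W := by
  have hr : ∀ y, reduce (U.mulVec y) = (U.map (residue O)).mulVec (reduce y) := fun y => by
    funext i
    simp only [reduce_apply, Matrix.mulVec, dotProduct, map_sum, map_mul, Matrix.map_apply]
  constructor
  · intro H w hw
    obtain ⟨y, rfl⟩ := reduce_surjective w
    have := H _ (frame_mem_ofSubspace.2 hw)
    rwa [hU, frame_mem_ofSubspace, hr] at this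
  · rintro H _ ⟨y, hy, rfl⟩
    rw [hU, frame_mem_ofSubspace, hr]
    exact H _ hy

/-- If the quadratic polynomial of `g` has no root in the residue field, then `g` fixes no neighbour
of `L`. -/
theorem Lattice.no_invariant_sublattice (L : Lattice O K) {ϖ : O} (hϖ : Irreducible ϖ)
    {g : Matrix (Fin 2) (Fin 2) K} (hg : ∀ x ∈ L.1, g.mulVec x ∈ L.1) {t n : O}
    (ht : g.trace = algebraMap O K t) (hn : g.det = algebraMap O K n)
    (hroot : ∀ c, c ^ 2 - residue O t * c + residue O n ≠ 0) {N : Submodule O (Fin 2 → K)}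
    (h1 : ϖ • L.1 < N) (h2 : N < L.1) : ¬ ∀ x ∈ N, g.mulVec x ∈ N := by
  obtain ⟨h, hL⟩ := L.exists_eq_range_frame
  rw [hL] at hg h1 h2
  obtain ⟨U, htU, hnU, hU⟩ := exists_matrix_of_mapsTo h hg
  obtain ⟨W, rfl⟩ := exists_ofSubspace_eq h hϖ h1.le h2.le
  rw [← ofSubspace_bot h hϖ, ofSubspace_lt_iff] at h1
  rw [← ofSubspace_top h, ofSubspace_lt_iff] at h2
  rw [mapsTo_ofSubspace_iff h hU]
  refine no_invariant_line _ (fun c => ?_) h1 h2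
  convert hroot c using 3
  · rw [IsFractionRing.injective O K (ht.symm.trans htU)]
    simp [Matrix.trace_fin_two]
  · rw [IsFractionRing.injective O K (hn.symm.trans hnU)]
    simp [Matrix.det_fin_two]

/-- If the quadratic polynomial of `g` has two distinct roots in the residue field, then `g` fixes
exactly two neighbours of `L`. -/
theorem Lattice.exists_two_invariant_sublattices (L : Lattice O K) {ϖ : O} (hϖ : Irreducible ϖ)
    {g : Matrix (Fin 2) (Fin 2) K} (hg : ∀ x ∈ L.1, g.mulVec x ∈ L.1) {t n : O}
    (ht : g.trace = algebraMap O K t) (hn : g.det = algebraMap O K n)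
    {a b : ResidueField O} (hab : a ≠ b) (hat : a + b = residue O t) (han : a * b = residue O n) :
    ∃ N₁ N₂ : Submodule O (Fin 2 → K), N₁ ≠ N₂ ∧
      ∀ N, (ϖ • L.1 < N ∧ N < L.1 ∧ ∀ x ∈ N, g.mulVec x ∈ N) ↔ (N = N₁ ∨ N = N₂) := by
  obtain ⟨h, hL⟩ := L.exists_eq_range_frame
  rw [hL] at hg ⊢
  obtain ⟨U, htU, hnU, hU⟩ := exists_matrix_of_mapsTo h hg
  obtain ⟨W₁, W₂, hW, hiff⟩ := exists_two_invariant_lines (U.map (residue O)) hab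
    (by rw [hat, IsFractionRing.injective O K (ht.symm.trans htU)]; simp [Matrix.trace_fin_two])
    (by rw [han, IsFractionRing.injective O K (hn.symm.trans hnU)]; simp [Matrix.det_fin_two])
  have key : ∀ W, (ϖ • LinearMap.range (frame h) < ofSubspace h W ∧
      ofSubspace h W < LinearMap.range (frame h) ∧
      ∀ x ∈ ofSubspace h W, g.mulVec x ∈ ofSubspace h W) ↔ (W = W₁ ∨ W = W₂) := fun W => by
    rw [← hiff, ← ofSubspace_bot h hϖ, ← ofSubspace_top h, ofSubspace_lt_iff, ofSubspace_lt_iff,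
      mapsTo_ofSubspace_iff h hU]
  refine ⟨ofSubspace h W₁, ofSubspace h W₂, (ofSubspace_injective h).ne hW, fun N => ⟨?_, ?_⟩⟩
  · intro hN
    obtain ⟨W, rfl⟩ := exists_ofSubspace_eq h hϖ hN.1.le hN.2.1.le
    exact ((key W).1 hN).imp (congrArg _) (congrArg _)
  · rintro (rfl | rfl)
    · exact (key W₁).2 (Or.inl rfl)
    · exact (key W₂).2 (Or.inr rfl)

/-! ### Neighbours of a vertex -/

theorem isLattice_of_between {L : Lattice O K} {ϖ : O} (hϖ : Irreducible ϖ)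
    {N : Submodule O (Fin 2 → K)} (h1 : ϖ • L.1 < N) (h2 : N < L.1) :
    Submodule.IsLattice K N := by
  have := L.2
  have h0 : algebraMap O K ϖ ≠ 0 := by simpa using hϖ.ne_zero
  have hN : IsNoetherian O L.1 := inferInstance
  refine ⟨?_, ?_⟩
  · have := isNoetherian_of_le h2.le
    exact (Module.Finite.iff_fg (N := N)).1 inferInstance
  · rw [eq_top_iff, ← this.span_eq_top, Submodule.span_le]
    intro x hx
    have h3 : ϖ • x ∈ N := h1.le (Submodule.smul_mem_pointwise_smul _ _ _ hx)
    have h4 : x = (algebraMap O K ϖ)⁻¹ • (ϖ • x) := by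
      rw [← algebraMap_smul K ϖ x, smul_smul, inv_mul_cancel₀ h0, one_smul]
    rw [h4]
    exact Submodule.smul_mem _ _ (Submodule.subset_span h3)

omit [IsDomain O] [IsDiscreteValuationRing O] [IsFractionRing O K] in
theorem units_smul_lt_units_smul (c : Kˣ) {N N' : Submodule O (Fin 2 → K)} (h : N < N') :
    c • N < c • N' := by
  refine lt_of_le_of_ne ?_ fun h' => h.ne (smul_left_cancel c h')
  rintro _ ⟨y, hy, rfl⟩
  exact ⟨y, h.le hy, rfl⟩

/-- Homothetic lattices strictly between `ϖL` and `L` are equal. -/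
theorem eq_of_homothetic {L N N' : Submodule O (Fin 2 → K)} {ϖ : O}
    (hϖ : Irreducible ϖ) (hN1 : ϖ • L < N) (hN2 : N < L) (hN1' : ϖ • L < N') (hN2' : N' < L)
    {c : Kˣ} (h : N' = c • N) : N' = N := by
  -- it suffices to compare when `c` is integral
  have key : ∀ {N N' : Submodule O (Fin 2 → K)} {c : Kˣ} {a : O}, algebraMap O K a = c → N < L →
      ϖ • L < N' → N' = c • N → N' = N := by
    intro N N' c a ha hN hN' h
    have hsm : ∀ y : Fin 2 → K, c • y = a • y := fun y => by
      rw [Units.smul_def, ← ha, algebraMap_smul]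
    have hle : N' ≤ N := by
      rw [h]
      rintro _ ⟨y, hy, rfl⟩
      change c • y ∈ N
      rw [hsm]
      exact N.smul_mem a hy
    refine le_antisymm hle ?_
    by_cases hu : IsUnit a
    · obtain ⟨b, hb⟩ := hu.exists_left_inv
      intro y hy
      rw [h]
      refine ⟨b • y, N.smul_mem b hy, ?_⟩
      change c • b • y = y
      rw [hsm, smul_smul, mul_comm, hb, one_smul]
    · exfalso
      have : a ∈ maximalIdeal O := hu
      rw [hϖ.maximalIdeal_eq, Ideal.mem_span_singleton] at this
      obtain ⟨b, rfl⟩ := this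
      refine hN'.not_ge ?_
      rw [h]
      rintro _ ⟨y, hy, rfl⟩
      refine ⟨b • y, L.smul_mem b (hN.le hy), ?_⟩
      change ϖ • b • y = c • y
      rw [hsm, smul_smul]
  rcases ValuationRing.isInteger_or_isInteger O (c : K) with ⟨a, ha⟩ | ⟨a, ha⟩
  · exact key ha hN2 hN1' h
  · refine (key (c := c⁻¹) (by rw [ha, Units.val_inv_eq_inv_val]) hN2' hN1 ?_).symm
    rw [h, inv_smul_smul]

/-- The neighbours of the class of `L` are the classes of the lattices strictly between `ϖL` and
`L`, for a fixed uniformizer `ϖ` and a fixed representative `L`. -/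
theorem adj_mk_iff {L : Lattice O K} {ϖ : O} (hϖ : Irreducible ϖ) {w : Vertex O K} :
    Adj w (Vertex.mk L) ↔ ∃ N : Lattice O K, Vertex.mk N = w ∧ ϖ • L.1 < N.1 ∧ N.1 < L.1 := by
  have hass : ∀ {ϖ' : O}, Irreducible ϖ' → ∀ L : Submodule O (Fin 2 → K), ϖ' • L = ϖ • L := by
    intro ϖ' hϖ' L
    obtain ⟨u, rfl⟩ := IsDiscreteValuationRing.associated_of_irreducible O hϖ hϖ'
    ext x
    constructor
    · rintro ⟨y, hy, rfl⟩
      exact ⟨(u : O) • y, L.smul_mem _ hy, smul_smul _ _ _⟩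
    · rintro ⟨y, hy, rfl⟩
      refine ⟨(↑u⁻¹ : O) • y, L.smul_mem _ hy, ?_⟩
      change (ϖ * ↑u) • (↑u⁻¹ : O) • y = ϖ • y
      rw [smul_smul, mul_assoc, Units.mul_inv, mul_one]
  constructor
  · intro h
    obtain ⟨L', N, hL', rfl, ϖ', hϖ', h1, h2⟩ := h.symm
    rw [hass hϖ'] at h1
    obtain ⟨c, hc⟩ := Vertex.mk_eq_mk.1 hL'
    have := N.2
    refine ⟨⟨c • N.1, inferInstance⟩, (Vertex.mk_eq_mk.2 ⟨c, rfl⟩).symm, ?_, ?_⟩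
    · change ϖ • L.1 < c • N.1
      have : ϖ • c • L'.1 = c • ϖ • L'.1 := by
        ext x
        constructor
        · rintro ⟨_, ⟨y, hy, rfl⟩, rfl⟩
          exact ⟨_, ⟨y, hy, rfl⟩, smul_comm c ϖ y⟩
        · rintro ⟨_, ⟨y, hy, rfl⟩, rfl⟩
          exact ⟨_, ⟨y, hy, rfl⟩, smul_comm ϖ c y⟩
      rw [hc, this]
      exact units_smul_lt_units_smul c h1
    · change c • N.1 < L.1
      rw [hc]
      exact units_smul_lt_units_smul c h2
  · rintro ⟨N, rfl, h1, h2⟩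
    exact Adj.symm ⟨L, N, rfl, rfl, ϖ, hϖ, h1, h2⟩

end BruhatTits

/-! ### Trace and norm of elements of a form of the matrix algebra -/

section TraceNorm

variable {F E B : Type*} [Field F] [Field E] [Algebra F E] [Ring B] [Algebra F B] [Nontrivial B]

theorem eq_zero_of_smul_one_add_smul {x : B} (hx : x ∉ Set.range (algebraMap F B)) {c d : F}
    (h : c • (1 : B) + d • x = 0) : c = 0 ∧ d = 0 := by
  have hd : d = 0 := by
    by_contra hd
    refine hx ⟨-(d⁻¹ * c), ?_⟩
    have h1 : x = d⁻¹ • d • x := by rw [smul_smul, inv_mul_cancel₀ hd, one_smul]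
    rw [h1, eq_neg_of_add_eq_zero_right h, smul_neg, smul_smul, Algebra.algebraMap_eq_smul_one,
      neg_smul]
  subst hd
  simpa using h

theorem smul_one_add_ne_smul_one {x : B} (hx : x ∉ Set.range (algebraMap F B)) {c s : F} :
    c • (1 : B) + x ≠ s • 1 := fun h =>
  one_ne_zero (eq_zero_of_smul_one_add_smul hx (c := c - s) (d := 1)
    (by rw [sub_smul, ← h]; module)).2

theorem eq_of_smul_one_add_eq_smul {x : B} (hx : x ∉ Set.range (algebraMap F B)) {c d s : F}
    (h : d • (1 : B) + x = s • (c • (1 : B) + x)) : c = d := by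
  obtain ⟨h2, h3⟩ := eq_zero_of_smul_one_add_smul hx (c := d - s * c) (d := 1 - s) (by
    rw [← sub_eq_zero.2 h]
    module)
  rw [← sub_eq_zero.1 h3, one_mul, sub_eq_zero] at h2
  exact h2.symm

theorem linearIndependent_one_pair {x : B} (hx : x ∉ Set.range (algebraMap F B)) :
    LinearIndependent F ![1, x] :=
  LinearIndependent.pair_iff.2 fun _ _ h => eq_zero_of_smul_one_add_smul hx h

/-- An element outside `F` of a form of `M₂` is a root of its quadratic characteristic polynomial,
whose coefficients lie in `F`. -/
theorem exists_trace_det (φ : E ⊗[F] B ≃ₐ[E] Matrix (Fin 2) (Fin 2) E) {x : B}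
    (hx : x ∉ Set.range (algebraMap F B)) :
    ∃ t n : F, (φ (1 ⊗ₜ x)).trace = algebraMap F E t ∧ (φ (1 ⊗ₜ x)).det = algebraMap F E n ∧
      x ^ 2 = t • x - n • 1 := by
  set g := φ (1 ⊗ₜ x) with hg
  have hCH : g ^ 2 = g.trace • g - g.det • 1 := by
    have := Matrix.aeval_self_charpoly g
    rw [Matrix.charpoly_fin_two] at this
    simp only [map_add, map_sub, map_pow, aeval_X, map_mul, aeval_C,
      Algebra.algebraMap_eq_smul_one] at this
    rw [← sub_eq_zero, ← this, smul_mul_assoc, one_mul]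
    abel
  have hg2 : g ^ 2 = φ (1 ⊗ₜ (x ^ 2)) := by
    rw [hg, ← map_pow, Algebra.TensorProduct.tmul_pow, one_pow]
  have hone : (1 : Matrix (Fin 2) (Fin 2) E) = φ (1 ⊗ₜ 1) := (map_one φ).symm
  have hdep : ¬ LinearIndependent F ![1, x, x ^ 2] := by
    intro h
    have h1 := (Module.Flat.linearIndependent_one_tmul (S := E) h).map' φ.toLinearMap
      (LinearMap.ker_eq_bot.2 φ.injective)
    have h2 := Fintype.linearIndependent_iff.1 h1 ![g.det, -g.trace, 1] (by
      simp only [Fin.sum_univ_three, Function.comp]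
      change g.det • φ (1 ⊗ₜ 1) + (-g.trace) • φ (1 ⊗ₜ x) + (1 : E) • φ (1 ⊗ₜ (x ^ 2)) = 0
      rw [← hg, ← hg2, ← hone, hCH]
      module) 2
    simp at h2
  obtain ⟨t, n, htn⟩ : ∃ t n : F, x ^ 2 = t • x - n • 1 := by
    by_contra hcon
    apply hdep
    rw [Fintype.linearIndependent_iff]
    intro c hc
    simp only [Fin.sum_univ_three] at hc
    change c 0 • (1 : B) + c 1 • x + c 2 • x ^ 2 = 0 at hc
    have h2 : c 2 = 0 := by
      by_contra h2
      refine hcon ⟨-((c 2)⁻¹ * c 1), (c 2)⁻¹ * c 0, ?_⟩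
      have h3 : x ^ 2 = (c 2)⁻¹ • c 2 • x ^ 2 := by
        rw [smul_smul, inv_mul_cancel₀ h2, one_smul]
      rw [h3, eq_neg_of_add_eq_zero_right hc]
      module
    rw [h2, zero_smul, add_zero] at hc
    obtain ⟨h3, h4⟩ := eq_zero_of_smul_one_add_smul hx hc
    intro i
    fin_cases i
    · exact h3
    · exact h4
    · exact h2
  have h3 : (g.trace - algebraMap F E t) • g = (g.det - algebraMap F E n) • 1 := by
    have h4 : g ^ 2 = algebraMap F E t • g - algebraMap F E n • 1 := by
      rw [hg2, htn, TensorProduct.tmul_sub, TensorProduct.tmul_smul, TensorProduct.tmul_smul, hone,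
        map_sub, ← algebraMap_smul E t, ← algebraMap_smul E n, map_smul, map_smul]
    rw [hCH] at h4
    rw [sub_smul, sub_smul, sub_eq_sub_iff_add_eq_add]
    rw [sub_eq_sub_iff_add_eq_add] at h4
    rw [h4, add_comm]
  have h5 := (Module.Flat.linearIndependent_one_tmul (S := E)
    (linearIndependent_one_pair (F := F) hx)).map' φ.toLinearMap
    (LinearMap.ker_eq_bot.2 φ.injective)
  have h6 := Fintype.linearIndependent_iff.1 h5
    ![-(g.det - algebraMap F E n), g.trace - algebraMap F E t] (by
      simp only [Fin.sum_univ_two, Function.comp]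
      change (-(g.det - algebraMap F E n)) • φ (1 ⊗ₜ 1) +
        (g.trace - algebraMap F E t) • φ (1 ⊗ₜ x) = 0
      rw [← hg, ← hone, h3]
      module)
  refine ⟨t, n, ?_, ?_, htn⟩
  · simpa [sub_eq_zero] using h6 1
  · have := h6 0
    simp only [Matrix.cons_val_zero, neg_eq_zero, sub_eq_zero] at this
    exact this

/-- The coefficients of the quadratic polynomial of an integral element are integral. -/
theorem trace_norm_mem_of_isIntegral {A : Type*} [CommRing A] [IsDomain A] [IsIntegrallyClosed A]
    [Algebra A F] [IsFractionRing A F] [Algebra A B] [IsScalarTower A F B] {x : B}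
    (hx : x ∉ Set.range (algebraMap F B)) (hint : IsIntegral A x) {t n : F}
    (h : x ^ 2 = t • x - n • 1) :
    t ∈ Set.range (algebraMap A F) ∧ n ∈ Set.range (algebraMap A F) := by
  obtain ⟨f, hf, hfx⟩ := hint
  rw [← aeval_def] at hfx
  set g : F[X] := X ^ 2 - C t * X + C n with hg
  have hgm : g.Monic := by rw [hg]; monicity!
  have hgd : g.natDegree = 2 := by rw [hg]; compute_degree!
  have hgx : aeval x g = 0 := by
    simp only [hg, map_add, map_sub, map_pow, aeval_X, map_mul, aeval_C, h,
      Algebra.algebraMap_eq_smul_one, smul_mul_assoc, one_mul]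
    abel
  have hdvd : g ∣ f.map (algebraMap A F) := by
    rw [← modByMonic_eq_zero_iff_dvd hgm]
    set r := f.map (algebraMap A F) %ₘ g with hr
    have hrd : r.natDegree < 2 := by
      rw [← hgd]
      exact natDegree_modByMonic_lt _ hgm fun h1 => by simp [h1] at hgd
    have hrx : aeval x r = 0 := by
      rw [hr, modByMonic_eq_sub_mul_div, map_sub, map_mul, hgx, zero_mul, sub_zero,
        aeval_map_algebraMap, hfx]
    clear_value r
    have hr1 : r = C (r.coeff 1) * X + C (r.coeff 0) :=
      eq_X_add_C_of_natDegree_le_one (by omega)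
    rw [hr1] at hrx
    simp only [map_add, aeval_X, map_mul, aeval_C,
      Algebra.algebraMap_eq_smul_one, smul_mul_assoc, one_mul] at hrx
    obtain ⟨h3, h4⟩ := eq_zero_of_smul_one_add_smul hx (c := r.coeff 0)
      (d := r.coeff 1) (by rw [add_comm]; exact hrx)
    rw [hr1, h3, h4]
    simp
  obtain ⟨g', hg'⟩ := IsIntegrallyClosed.eq_map_mul_C_of_dvd F hf hdvd
  rw [hgm.leadingCoeff, C_1, mul_one] at hg'
  constructor
  · refine ⟨-g'.coeff 1, ?_⟩
    rw [map_neg, ← coeff_map, hg', hg]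
    simp [coeff_C]
  · refine ⟨g'.coeff 0, ?_⟩
    rw [← coeff_map, hg', hg]
    simp

/-- If `E ⊗ B` is a division algebra, then the quadratic polynomial of an element of `B` outside `F`
has no root in `E`. -/
theorem no_root_of_forall_isUnit (hE : ∀ z : E ⊗[F] B, z ≠ 0 → IsUnit z) {x : B}
    (hx : x ∉ Set.range (algebraMap F B)) {t n : F} (h : x ^ 2 = t • x - n • 1) (r : E) :
    r ^ 2 - algebraMap F E t * r + algebraMap F E n ≠ 0 := by
  intro hr
  have h5 := Module.Flat.linearIndependent_one_tmul (S := E)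
    (linearIndependent_one_pair (F := F) hx)
  have hne : ∀ s : E, (1 : E) ⊗ₜ[F] x - s • (1 ⊗ₜ[F] (1 : B)) ≠ 0 := by
    intro s hs
    have h6 := Fintype.linearIndependent_iff.1 h5 ![-s, 1] (by
      simp only [Fin.sum_univ_two]
      change (-s) • ((1 : E) ⊗ₜ[F] (1 : B)) + (1 : E) • ((1 : E) ⊗ₜ[F] x) = 0
      rw [← hs]
      module) 1
    simp at h6
  have hone : (1 : E) ⊗ₜ[F] (1 : B) = 1 := rfl
  have hsq : (1 : E) ⊗ₜ[F] x * (1 : E) ⊗ₜ[F] x =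
      algebraMap F E t • ((1 : E) ⊗ₜ[F] x) - algebraMap F E n • 1 := by
    rw [Algebra.TensorProduct.tmul_mul_tmul, mul_one, ← sq, h, TensorProduct.tmul_sub,
      TensorProduct.tmul_smul, TensorProduct.tmul_smul, hone, ← algebraMap_smul E t,
      ← algebraMap_smul E n]
  have hprod : ((1 : E) ⊗ₜ[F] x - r • (1 ⊗ₜ[F] (1 : B))) *
      ((1 : E) ⊗ₜ[F] x - (algebraMap F E t - r) • (1 ⊗ₜ[F] (1 : B))) = 0 := by
    rw [hone, sub_mul, mul_sub, mul_sub, hsq, mul_smul_comm, mul_one, smul_mul_assoc, one_mul,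
      smul_mul_assoc, one_mul, smul_smul]
    have : algebraMap F E n = r * (algebraMap F E t - r) := by linear_combination hr
    rw [this]
    module
  exact hne _ ((hE _ (hne r)).mul_right_eq_zero.1 hprod)

end TraceNorm

/-! ### The place at infinity -/

theorem RatFunc.CompletionAtInfty.valued_algebraMap {k : Type*} [Field k]
    [DecidableEq (RatFunc k)] (f : RatFunc k) :
    Valued.v (algebraMap (RatFunc k) (RatFunc.CompletionAtInfty k) f) =
      RatFunc.inftyValuation k f := by
  let := RatFunc.inftyValued k
  exact Valued.valuedCompletion_apply f

/-- A quadratic polynomial `X² - tX + n` with `n` constant and `t` a non-constant polynomial has a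
root in `F_∞`. -/
theorem exists_root_completionAtInfty {k : Type*} [Field k] [DecidableEq (RatFunc k)]
    {t : k[X]} (ht : t.natDegree ≠ 0)
    (n : k) : ∃ r : RatFunc.CompletionAtInfty k,
      r ^ 2 - algebraMap (RatFunc k) _ (algebraMap k[X] (RatFunc k) t) * r +
        algebraMap (RatFunc k) _ (algebraMap k[X] (RatFunc k) (C n)) = 0 := by
  have ht0 : t ≠ 0 := by rintro rfl; simp at ht
  set T := algebraMap k[X] (RatFunc k) t with hT
  set N := algebraMap k[X] (RatFunc k) (C n) with hN
  have hT0 : T ≠ 0 := by simpa [hT] using ht0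
  have hv : RatFunc.inftyValuation k (N / T ^ 2) < 1 := by
    have h1 : RatFunc.inftyValuation k T = WithZero.exp (t.natDegree : ℤ) :=
      RatFunc.inftyValuation.polynomial k ht0
    have h2 : RatFunc.inftyValuation k N ≤ 1 := by
      by_cases hn : n = 0
      · simp [hN, hn]
      · have h3 := RatFunc.inftyValuation.polynomial k (p := C n) (by simpa using hn)
        rw [natDegree_C] at h3
        exact h3.le
    rw [map_div₀, map_pow, h1, div_lt_one₀ (by simp)]
    refine h2.trans_lt ?_
    rw [← WithZero.exp_nsmul, ← WithZero.exp_zero, WithZero.exp_lt_exp]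
    simp
    omega
  have : CompleteSpace (RatFunc.CompletionAtInfty k) := by
    let := RatFunc.inftyValued k
    exact inferInstanceAs (CompleteSpace (UniformSpace.Completion (RatFunc k)))
  have : T2Space (RatFunc.CompletionAtInfty k) := by
    let := RatFunc.inftyValued k
    exact inferInstanceAs (T2Space (UniformSpace.Completion (RatFunc k)))
  obtain ⟨y, hy⟩ := Valued.exists_sq_sub_self_add_eq_zero
    (c := algebraMap (RatFunc k) (RatFunc.CompletionAtInfty k) (N / T ^ 2))
    (by rwa [RatFunc.CompletionAtInfty.valued_algebraMap])
  -- `X = tY` turns `X² - tX + n` into `t² (Y² - Y + n / t²)`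
  refine ⟨algebraMap _ _ T * y, ?_⟩
  have h1 : algebraMap (RatFunc k) (RatFunc.CompletionAtInfty k) N =
      algebraMap (RatFunc k) (RatFunc.CompletionAtInfty k) T ^ 2 *
        algebraMap (RatFunc k) (RatFunc.CompletionAtInfty k) (N / T ^ 2) := by
    rw [← map_pow, ← map_mul, mul_div_cancel₀ _ (pow_ne_zero 2 hT0)]
  rw [h1]
  linear_combination (algebraMap (RatFunc k) (RatFunc.CompletionAtInfty k) T) ^ 2 * hy

/-! ### The ring `A[𝔭⁻¹]` -/

section Away

open IsDedekindDomain.HeightOneSpectrum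

variable {k : Type*} [Field k] {𝔭 : HeightOneSpectrum k[X]} {P : k[X]}

theorem generator_ne_zero (hP : 𝔭.asIdeal = Ideal.span {P}) : P ≠ 0 := by
  rintro rfl
  exact 𝔭.ne_bot (by simpa using hP)

theorem valuation_generator (hP : 𝔭.asIdeal = Ideal.span {P}) :
    𝔭.valuation (RatFunc k) (algebraMap k[X] (RatFunc k) P) = WithZero.exp (-1 : ℤ) := by
  rw [valuation_of_algebraMap, 𝔭.intValuation_singleton (generator_ne_zero hP) hP]

theorem valuation_generator_of_ne (hP : 𝔭.asIdeal = Ideal.span {P}) {v : HeightOneSpectrum k[X]}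
    (hv : v ≠ 𝔭) : v.valuation (RatFunc k) (algebraMap k[X] (RatFunc k) P) = 1 := by
  rw [valuation_eq_one_iff_notMem]
  intro h
  refine hv (HeightOneSpectrum.ext ?_)
  refine (𝔭.isMaximal.eq_of_le v.isPrime.ne_top ?_).symm
  rw [hP, Ideal.span_singleton_le_iff_mem]
  exact h

theorem exists_unit_awayFrom (hP : 𝔭.asIdeal = Ideal.span {P}) :
    ∃ s : (awayFrom 𝔭)ˣ, ((s : awayFrom 𝔭) : RatFunc k) = algebraMap k[X] (RatFunc k) P := by
  have h0 : algebraMap k[X] (RatFunc k) P ≠ 0 := by simpa using generator_ne_zero hP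
  refine ⟨⟨⟨algebraMap k[X] (RatFunc k) P, fun v _ => v.valuation_le_one P⟩,
    ⟨(algebraMap k[X] (RatFunc k) P)⁻¹, fun v hv => ?_⟩, ?_, ?_⟩, rfl⟩
  · rw [map_inv₀, valuation_generator_of_ne hP hv, inv_one]
  · exact Subtype.ext (mul_inv_cancel₀ h0)
  · exact Subtype.ext (inv_mul_cancel₀ h0)

theorem exists_pow_mul_eq_algebraMap (hP : 𝔭.asIdeal = Ideal.span {P}) (s : awayFrom 𝔭) :
    ∃ (N : ℕ) (a : k[X]), algebraMap k[X] (RatFunc k) a =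
      algebraMap k[X] (RatFunc k) P ^ N * (s : RatFunc k) := by
  obtain ⟨N, hN⟩ : ∃ N : ℕ, 𝔭.valuation (RatFunc k) (s : RatFunc k) ≤ WithZero.exp (N : ℤ) := by
    by_cases h : (s : RatFunc k) = 0
    · exact ⟨0, by simp [h]⟩
    · refine ⟨(WithZero.log (𝔭.valuation (RatFunc k) (s : RatFunc k))).toNat, ?_⟩
      refine WithZero.le_exp_log.trans ?_
      rw [WithZero.exp_le_exp]
      exact Int.self_le_toNat _
  obtain ⟨a, ha⟩ := mem_integers_of_valuation_le_one (R := k[X]) (RatFunc k)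
    (algebraMap k[X] (RatFunc k) P ^ N * (s : RatFunc k)) (fun v => by
      rw [map_mul, map_pow]
      by_cases hv : v = 𝔭
      · subst hv
        rw [valuation_generator hP]
        refine (mul_le_mul_right hN _).trans ?_
        rw [← WithZero.exp_nsmul, ← WithZero.exp_add]
        simp
      · rw [valuation_generator_of_ne hP hv, one_pow, one_mul]
        exact s.2 v hv)
  exact ⟨N, a, ha⟩

/-- An element of `F` that is integral at `𝔭` and becomes a polynomial after multiplication by a
power of a generator of `𝔭` is a polynomial. -/
theorem mem_range_of_pow_mul_mem_range (hP : 𝔭.asIdeal = Ideal.span {P}) {f : RatFunc k} {N : ℕ}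
    (hf : algebraMap k[X] (RatFunc k) P ^ N * f ∈ Set.range (algebraMap k[X] (RatFunc k)))
    (hf' : algebraMap (RatFunc k) (localField 𝔭) f ∈
      Set.range (algebraMap (localIntegers 𝔭) (localField 𝔭))) :
    f ∈ Set.range (algebraMap k[X] (RatFunc k)) := by
  refine mem_integers_of_valuation_le_one (R := k[X]) (RatFunc k) f fun v => ?_
  by_cases hv : v = 𝔭
  · subst hv
    obtain ⟨z, hz⟩ := hf'
    have h1 := z.2
    rw [mem_adicCompletionIntegers] at h1
    rw [← valuedAdicCompletion_eq_valuation']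
    change Valued.v (algebraMap (RatFunc k) (localField v) f) ≤ 1
    rw [← hz]
    exact h1
  · obtain ⟨a, ha⟩ := hf
    have h1 : v.valuation (RatFunc k) (algebraMap k[X] (RatFunc k) a) ≤ 1 := v.valuation_le_one a
    rw [ha, map_mul, map_pow,
      valuation_generator_of_ne hP hv, one_pow, one_mul] at h1
    exact h1

end Away

/-! ### The ring `M ⊗ A[𝔭⁻¹]` -/

section OrderAway

variable {k : Type*} [Field k] {𝔭 : HeightOneSpectrum k[X]}
  {B : Type*} [Ring B] [Algebra k[X] B] {M : Subalgebra k[X] B}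

/-- A power of a generator of `𝔭` clears the denominators of an element of `M ⊗ A[𝔭⁻¹]`. -/
theorem OrderAway.exists_pow_mul_eq {P : k[X]} (hP : 𝔭.asIdeal = Ideal.span {P})
    (x : OrderAway 𝔭 M) : ∃ (N : ℕ) (m : M),
      algebraMap k[X] (OrderAway 𝔭 M) P ^ N * x = m ⊗ₜ 1 := by
  induction x using TensorProduct.induction_on with
  | zero => exact ⟨0, 0, by simp⟩
  | tmul m s =>
    obtain ⟨N, a, ha⟩ := exists_pow_mul_eq_algebraMap hP s
    refine ⟨N, a • m, ?_⟩
    rw [← map_pow, ← Algebra.smul_def, TensorProduct.smul_tmul, ← TensorProduct.tmul_smul]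
    congr 1
    apply Subtype.ext
    rw [Algebra.smul_def, Algebra.smul_def, map_pow, mul_one]
    exact ha.symm
  | add x y hx hy =>
    obtain ⟨N, m, hm⟩ := hx
    obtain ⟨N', m', hm'⟩ := hy
    refine ⟨N + N', P ^ N' • m + P ^ N • m', ?_⟩
    have hsm : ∀ (a : k[X]) (m : M), (a • m) ⊗ₜ[k[X]] (1 : awayFrom 𝔭) =
        algebraMap k[X] (OrderAway 𝔭 M) a * m ⊗ₜ 1 := fun a m => by
      rw [← Algebra.smul_def, TensorProduct.smul_tmul']
    rw [TensorProduct.add_tmul, hsm, hsm, ← hm, ← hm', map_pow, map_pow, mul_add, ← mul_assoc,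
      ← mul_assoc, ← pow_add, ← pow_add, add_comm N' N]

theorem OrderAway.isUnit_algebraMap {P : k[X]} (hP : 𝔭.asIdeal = Ideal.span {P}) :
    IsUnit (algebraMap k[X] (OrderAway 𝔭 M) P) := by
  obtain ⟨s, hs⟩ := exists_unit_awayFrom hP
  have h : algebraMap k[X] (OrderAway 𝔭 M) P =
      (Algebra.TensorProduct.includeRight : awayFrom 𝔭 →ₐ[k[X]] OrderAway 𝔭 M) s := by
    rw [← AlgHom.commutes Algebra.TensorProduct.includeRight]
    congr 1
    exact Subtype.ext hs.symm
  rw [h]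
  exact s.isUnit.map _

variable [Algebra (RatFunc k) B] [IsScalarTower k[X] (RatFunc k) B]

theorem OrderAway.toAlg_tmul (m : M) (s : awayFrom 𝔭) :
    OrderAway.toAlg 𝔭 M (m ⊗ₜ s) = (m : B) * algebraMap (RatFunc k) B s :=
  Algebra.TensorProduct.lift_tmul _ _ _ _ _

theorem OrderAway.toAlg_injective : Function.Injective (OrderAway.toAlg 𝔭 M) := by
  obtain ⟨P, hP⟩ : ∃ P, 𝔭.asIdeal = Ideal.span {P} :=
    (IsPrincipalIdealRing.principal 𝔭.asIdeal).principal
  rw [injective_iff_map_eq_zero]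
  intro x hx
  obtain ⟨N, m, hm⟩ := OrderAway.exists_pow_mul_eq hP x
  have h1 := congrArg (OrderAway.toAlg 𝔭 M) hm
  rw [map_mul, hx, mul_zero, OrderAway.toAlg_tmul] at h1
  have h2 : m = 0 := by
    apply Subtype.ext
    simpa using h1.symm
  rw [h2, TensorProduct.zero_tmul] at hm
  exact ((OrderAway.isUnit_algebraMap hP).pow N).mul_right_eq_zero.1 hm

variable (φ : localField 𝔭 ⊗[RatFunc k] B ≃ₐ[localField 𝔭]
  Matrix (Fin 2) (Fin 2) (localField 𝔭))

variable (M)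

/-- The matrix over `F_𝔭` by which an element of `M ⊗ A[𝔭⁻¹]` acts. -/
def OrderAway.toMatrix : OrderAway 𝔭 M →+* Matrix (Fin 2) (Fin 2) (localField 𝔭) :=
  (φ : localField 𝔭 ⊗[RatFunc k] B →+* Matrix (Fin 2) (Fin 2) (localField 𝔭)).comp
    ((Algebra.TensorProduct.includeRight :
      B →ₐ[RatFunc k] localField 𝔭 ⊗[RatFunc k] B).toRingHom.comp
        (OrderAway.toAlg 𝔭 M).toRingHom)

variable {M}

theorem OrderAway.toMatrix_apply (x : OrderAway 𝔭 M) :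
    OrderAway.toMatrix M φ x = φ (1 ⊗ₜ OrderAway.toAlg 𝔭 M x) := rfl

theorem unitsToGL_val (u : (OrderAway 𝔭 M)ˣ) :
    (unitsToGL 𝔭 M φ u : Matrix (Fin 2) (Fin 2) (localField 𝔭)) = OrderAway.toMatrix M φ u := rfl

theorem OrderAway.toMatrix_of_toAlg_eq {x : OrderAway 𝔭 M} {f : RatFunc k}
    (h : OrderAway.toAlg 𝔭 M x = algebraMap (RatFunc k) B f) :
    OrderAway.toMatrix M φ x = algebraMap (RatFunc k) (localField 𝔭) f • 1 := by
  rw [OrderAway.toMatrix_apply, h, Algebra.algebraMap_eq_smul_one, TensorProduct.tmul_smul,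
    ← algebraMap_smul (localField 𝔭) f, map_smul]
  congr 1
  exact map_one φ

theorem OrderAway.toMatrix_algebraMap (a : k[X]) :
    OrderAway.toMatrix M φ (algebraMap k[X] (OrderAway 𝔭 M) a) =
      algebraMap k[X] (localField 𝔭) a • 1 := by
  rw [OrderAway.toMatrix_of_toAlg_eq φ (f := algebraMap k[X] (RatFunc k) a),
    ← IsScalarTower.algebraMap_apply]
  rw [AlgHom.commutes, IsScalarTower.algebraMap_apply k[X] (RatFunc k) B]

variable (M) in
/-- The elements of `M ⊗ A[𝔭⁻¹]` that map the `O`-module `N ⊆ F_𝔭²` to itself. For a lattice `N`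
this is an `A`-order. -/
def leftOrder (N : Submodule (localIntegers 𝔭) (Fin 2 → localField 𝔭)) :
    Subalgebra k[X] (OrderAway 𝔭 M) where
  carrier := {x | ∀ y ∈ N, (OrderAway.toMatrix M φ x).mulVec y ∈ N}
  mul_mem' {a b} ha hb y hy := by
    rw [map_mul, ← Matrix.mulVec_mulVec]
    exact ha _ (hb _ hy)
  add_mem' {a b} ha hb y hy := by
    rw [map_add, Matrix.add_mulVec]
    exact N.add_mem (ha _ hy) (hb _ hy)
  algebraMap_mem' a y hy := by
    rw [OrderAway.toMatrix_algebraMap, Matrix.smul_mulVec, Matrix.one_mulVec,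
      IsScalarTower.algebraMap_apply k[X] (localIntegers 𝔭) (localField 𝔭), algebraMap_smul]
    exact N.smul_mem _ hy

theorem unitsToGL_smul_eq_iff {N : BruhatTits.Lattice (localIntegers 𝔭) (localField 𝔭)}
    {u : (OrderAway 𝔭 M)ˣ} : unitsToGL 𝔭 M φ u • N = N ↔
      (u : OrderAway 𝔭 M) ∈ leftOrder M φ N.1 ∧ (↑u⁻¹ : OrderAway 𝔭 M) ∈ leftOrder M φ N.1 := by
  have key : ∀ {u : (OrderAway 𝔭 M)ˣ}, unitsToGL 𝔭 M φ u • N = N →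
      (u : OrderAway 𝔭 M) ∈ leftOrder M φ N.1 := by
    intro u hu y hy
    have : (OrderAway.toMatrix M φ (u : OrderAway 𝔭 M)).mulVec y ∈ (unitsToGL 𝔭 M φ u • N).1 :=
      ⟨y, hy, rfl⟩
    rwa [hu] at this
  constructor
  · intro h
    refine ⟨key h, key ?_⟩
    rw [map_inv, inv_smul_eq_iff, h]
  · rintro ⟨h1, h2⟩
    apply Subtype.ext
    ext y
    rw [BruhatTits.Lattice.mem_smul]
    constructor
    · rintro ⟨z, hz, rfl⟩
      exact h1 z hz
    · intro hy
      refine ⟨_, h2 y hy, ?_⟩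
      rw [unitsToGL_val, Matrix.mulVec_mulVec, ← map_mul, Units.mul_inv, map_one, Matrix.one_mulVec]

theorem isIntegral_of_isOrderIn (hM : IsOrderIn (RatFunc k) M) (m : M) :
    IsIntegral k[X] (m : B) := by
  have hM' : Submodule.IsLattice (RatFunc k) (Subalgebra.toSubmodule M) := hM
  have : Module.Finite k[X] M := Module.Finite.iff_fg.2 hM'.fg
  exact (IsIntegral.of_finite k[X] m).map M.val

variable [Nontrivial B]

/-- The trace and norm of an element of the left order of a lattice are polynomials. -/
theorem exists_trace_det_of_mem_leftOrder (hM : IsOrderIn (RatFunc k) M)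
    {L : BruhatTits.Lattice (localIntegers 𝔭) (localField 𝔭)} {x : OrderAway 𝔭 M}
    (hx : x ∈ leftOrder M φ L.1)
    (hxF : OrderAway.toAlg 𝔭 M x ∉ Set.range (algebraMap (RatFunc k) B)) :
    ∃ t n : k[X], (OrderAway.toMatrix M φ x).trace = algebraMap k[X] (localField 𝔭) t ∧
      (OrderAway.toMatrix M φ x).det = algebraMap k[X] (localField 𝔭) n ∧
      OrderAway.toAlg 𝔭 M x ^ 2 = algebraMap k[X] (RatFunc k) t • OrderAway.toAlg 𝔭 M x -
        algebraMap k[X] (RatFunc k) n • (1 : B) := by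
  obtain ⟨P, hP⟩ : ∃ P, 𝔭.asIdeal = Ideal.span {P} :=
    (IsPrincipalIdealRing.principal 𝔭.asIdeal).principal
  obtain ⟨t, n, ht, hn, htn⟩ := exists_trace_det φ hxF
  obtain ⟨N, m, hm⟩ := OrderAway.exists_pow_mul_eq hP x
  have h1 := congrArg (OrderAway.toAlg 𝔭 M) hm
  rw [map_mul, OrderAway.toAlg_tmul, OneMemClass.coe_one, map_one, mul_one, map_pow,
    AlgHom.commutes, IsScalarTower.algebraMap_apply k[X] (RatFunc k) B, ← map_pow,
    ← Algebra.smul_def] at h1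
  -- `m = p x` is integral over `A`, so `p t` and `p² n` are polynomials
  set p := algebraMap k[X] (RatFunc k) P ^ N with hp
  have hp0 : p ≠ 0 := pow_ne_zero _ (by simpa using generator_ne_zero hP)
  have hmF : (m : B) ∉ Set.range (algebraMap (RatFunc k) B) := by
    rintro ⟨f, hf⟩
    refine hxF ⟨p⁻¹ * f, ?_⟩
    rw [map_mul, hf, ← h1, ← Algebra.smul_def, smul_smul, inv_mul_cancel₀ hp0, one_smul]
  have hm2 : (m : B) ^ 2 = (p * t) • (m : B) - (p ^ 2 * n) • (1 : B) := by
    rw [← h1, _root_.smul_pow, htn, smul_sub, smul_smul, smul_smul, smul_smul]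
    congr 2
    ring
  obtain ⟨h2, h3⟩ := trace_norm_mem_of_isIntegral hmF (isIntegral_of_isOrderIn hM m) hm2
  obtain ⟨h, hL⟩ := L.exists_eq_range_frame
  obtain ⟨U, hU1, hU2, -⟩ := BruhatTits.exists_matrix_of_mapsTo h (hL ▸ hx)
  obtain ⟨t', rfl⟩ := mem_range_of_pow_mul_mem_range hP h2 ⟨U.trace, by rw [← hU1, ← ht]; rfl⟩
  obtain ⟨n', rfl⟩ := mem_range_of_pow_mul_mem_range hP (N := N * 2)
    (by rwa [pow_mul]) ⟨U.det, by rw [← hU2, ← hn]; rfl⟩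
  refine ⟨t', n', ?_, ?_, htn⟩
  · rw [IsScalarTower.algebraMap_apply k[X] (RatFunc k) (localField 𝔭)]; exact ht
  · rw [IsScalarTower.algebraMap_apply k[X] (RatFunc k) (localField 𝔭)]; exact hn

/-- The elements of `F` in the left order of a lattice are polynomials. -/
theorem exists_eq_algebraMap_of_mem_leftOrder (hM : IsOrderIn (RatFunc k) M)
    {L : BruhatTits.Lattice (localIntegers 𝔭) (localField 𝔭)} {x : OrderAway 𝔭 M}
    (hx : x ∈ leftOrder M φ L.1)
    (hxF : OrderAway.toAlg 𝔭 M x ∈ Set.range (algebraMap (RatFunc k) B)) :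
    ∃ a : k[X], x = algebraMap k[X] (OrderAway 𝔭 M) a := by
  obtain ⟨P, hP⟩ : ∃ P, 𝔭.asIdeal = Ideal.span {P} :=
    (IsPrincipalIdealRing.principal 𝔭.asIdeal).principal
  obtain ⟨f, hf⟩ := hxF
  obtain ⟨N, m, hm⟩ := OrderAway.exists_pow_mul_eq hP x
  have h1 := congrArg (OrderAway.toAlg 𝔭 M) hm
  rw [map_mul, OrderAway.toAlg_tmul, OneMemClass.coe_one, map_one, mul_one, map_pow,
    AlgHom.commutes, IsScalarTower.algebraMap_apply k[X] (RatFunc k) B, ← map_pow, ← hf,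
    ← map_mul] at h1
  have h2 : IsIntegral k[X] (algebraMap k[X] (RatFunc k) P ^ N * f) := by
    rw [← isIntegral_algebraMap_iff (algebraMap (RatFunc k) B).injective, h1]
    exact isIntegral_of_isOrderIn hM m
  have h3 := IsIntegrallyClosed.isIntegral_iff.1 h2
  obtain ⟨h, hL⟩ := L.exists_eq_range_frame
  obtain ⟨U, -, hU, -⟩ := BruhatTits.exists_matrix_of_mapsTo h (hL ▸ hx)
  rw [OrderAway.toMatrix_of_toAlg_eq φ hf.symm, Matrix.det_smul, Matrix.det_one, mul_one,
    Fintype.card_fin] at hU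
  have h4 : IsIntegral (localIntegers 𝔭) (algebraMap (RatFunc k) (localField 𝔭) f) := by
    refine IsIntegral.of_pow two_pos ?_
    rw [hU]
    exact isIntegral_algebraMap
  obtain ⟨a, rfl⟩ := mem_range_of_pow_mul_mem_range hP h3 (IsIntegrallyClosed.isIntegral_iff.1 h4)
  refine ⟨a, OrderAway.toAlg_injective ?_⟩
  rw [← hf, AlgHom.commutes, ← IsScalarTower.algebraMap_apply]

end OrderAway

/-! ### The residue field at `𝔭` -/

section Residue

open IsDedekindDomain.HeightOneSpectrum IsLocalRing

variable {k : Type*} [Field k] (𝔭 : HeightOneSpectrum k[X])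

theorem residue_eq_zero_iff_valued_lt_one (x : localIntegers 𝔭) :
    residue (localIntegers 𝔭) x = 0 ↔ Valued.v (x : localField 𝔭) < 1 := by
  rw [residue_eq_zero_iff, mem_maximalIdeal, mem_nonunits_iff,
    adicCompletionIntegers.isUnit_iff_valued_eq_one, ← not_iff_not, not_not, not_lt]
  exact ⟨fun h => h.ge, fun h => le_antisymm x.2 h⟩

/-- `A` surjects onto the residue field of `F_𝔭`, by density of `F` in `F_𝔭`. -/
theorem residue_comp_algebraMap_surjective : Function.Surjective
    ((residue (localIntegers 𝔭)).comp (algebraMap k[X] (localIntegers 𝔭))) := by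
  intro c
  obtain ⟨x, rfl⟩ := residue_surjective c
  have hU : {z : localField 𝔭 | Valued.v (z - (x : localField 𝔭)) < 1} ∈
      nhds (x : localField 𝔭) := by
    rw [Valued.mem_nhds]
    refine ⟨1, fun z hz => ?_⟩
    simpa using hz
  obtain ⟨f, hf⟩ := (denseRange_algebraMap (R := k[X]) (K := RatFunc k) (v := 𝔭)).exists_mem_open
    isOpen_interior ⟨_, mem_interior_iff_mem_nhds.2 hU⟩
  have hf1 : Valued.v (algebraMap (RatFunc k) (localField 𝔭) f - (x : localField 𝔭)) < 1 := by
    have h1 := interior_subset hf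
    exact h1
  have hf2 : Valued.v (algebraMap (RatFunc k) (localField 𝔭) f) ≤ 1 := by
    have h1 := Valuation.map_add (Valued.v (R := localField 𝔭))
      (algebraMap (RatFunc k) (localField 𝔭) f - (x : localField 𝔭)) x
    rw [sub_add_cancel] at h1
    exact h1.trans (max_le hf1.le x.2)
  have hval : ∀ g : RatFunc k, Valued.v (algebraMap (RatFunc k) (localField 𝔭) g) =
      𝔭.valuation (RatFunc k) g := fun g => valuedAdicCompletion_eq_valuation' 𝔭 g
  rw [hval] at hf2
  obtain ⟨a, ha⟩ := 𝔭.exists_valuation_sub_lt_of_integer hf2 1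
  refine ⟨a, ?_⟩
  rw [← sub_eq_zero, RingHom.comp_apply, ← map_sub, residue_eq_zero_iff_valued_lt_one]
  have h2 : ((algebraMap k[X] (localIntegers 𝔭) a - x : localIntegers 𝔭) : localField 𝔭) =
      algebraMap (RatFunc k) (localField 𝔭) (algebraMap k[X] (RatFunc k) a - f) +
        (algebraMap (RatFunc k) (localField 𝔭) f - (x : localField 𝔭)) := by
    rw [map_sub]
    change algebraMap (RatFunc k) (localField 𝔭) (algebraMap k[X] (RatFunc k) a) -
      (x : localField 𝔭) = _
    ring
  rw [h2]
  refine (Valuation.map_add _ _ _).trans_lt (max_lt ?_ hf1)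
  rw [hval]
  exact ha

theorem ker_residue_comp_algebraMap :
    RingHom.ker ((residue (localIntegers 𝔭)).comp (algebraMap k[X] (localIntegers 𝔭))) =
      𝔭.asIdeal := by
  ext a
  rw [RingHom.mem_ker, RingHom.comp_apply, residue_eq_zero_iff_valued_lt_one,
    ← 𝔭.valuation_lt_one_iff_mem (K := RatFunc k), ← valuedAdicCompletion_eq_valuation']
  rfl

theorem card_residueField [Finite k] :
    Nat.card (ResidueField (localIntegers 𝔭)) = Nat.card k ^ idealDegree 𝔭.asIdeal := by
  have h1 : Nat.card (ResidueField (localIntegers 𝔭)) = Nat.card (k[X] ⧸ 𝔭.asIdeal) := by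
    rw [← ker_residue_comp_algebraMap]
    exact (Nat.card_congr (RingHom.quotientKerEquivOfSurjective
      (residue_comp_algebraMap_surjective 𝔭)).toEquiv).symm
  obtain ⟨P, hP⟩ : ∃ P, 𝔭.asIdeal = Ideal.span {P} :=
    (IsPrincipalIdealRing.principal 𝔭.asIdeal).principal
  have hfin : Module.Finite k (k[X] ⧸ 𝔭.asIdeal) := by
    rw [hP]
    exact (AdjoinRoot.powerBasis (generator_ne_zero hP)).finite
  rw [h1, idealDegree, Module.natCard_eq_pow_finrank (K := k),
    Nat.log_pow Finite.one_lt_card]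

end Residue

/-! ### Stabilizers in `Γ₀` -/

namespace BruhatTits

variable {O K : Type*} [CommRing O] [IsDomain O] [IsDiscreteValuationRing O] [Field K]
  [Algebra O K] [IsFractionRing O K]

/-- A matrix that fixes a lattice `L` and the class of a lattice `N` strictly between `ϖL` and `L`
fixes `N`. -/
theorem Lattice.smul_eq_of_smul_mk_eq {L N : Lattice O K} {ϖ : O} (hϖ : Irreducible ϖ)
    (h1 : ϖ • L.1 < N.1) (h2 : N.1 < L.1) {g : GL (Fin 2) K} (hL : g • L = L)
    (hN : g • Vertex.mk N = Vertex.mk N) : g • N = N := by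
  have inj : Function.Injective
      ((Matrix.toLin' (g : Matrix (Fin 2) (Fin 2) K)).restrictScalars O) := fun a b hab =>
    Matrix.mulVec_injective_of_isUnit g.isUnit hab
  obtain ⟨c, hc⟩ := Vertex.mk_eq_mk.1 hN.symm
  have h3 : ϖ • L.1 < (g • N).1 := by
    refine lt_of_eq_of_lt ?_ (Submodule.map_strictMono_of_injective inj h1)
    conv_lhs => rw [← hL]
    ext x
    constructor
    · rintro ⟨_, ⟨y, hy, rfl⟩, rfl⟩
      exact ⟨ϖ • y, ⟨y, hy, rfl⟩, by simp⟩
    · rintro ⟨_, ⟨y, hy, rfl⟩, rfl⟩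
      exact ⟨_, ⟨y, hy, rfl⟩, by simp⟩
  have h4 : (g • N).1 < L.1 := by
    conv_rhs => rw [← hL]
    exact Submodule.map_strictMono_of_injective inj h2
  exact Subtype.ext (eq_of_homothetic hϖ h1 h2 h3 h4 hc)

end BruhatTits

section Gamma

open BruhatTits

variable {k : Type*} [Field k] {𝔭 : HeightOneSpectrum k[X]}
  {B : Type*} [Ring B] [Algebra k[X] B] {M : Subalgebra k[X] B}
  [Algebra (RatFunc k) B] [IsScalarTower k[X] (RatFunc k) B]
  (φ : localField 𝔭 ⊗[RatFunc k] B ≃ₐ[localField 𝔭] Matrix (Fin 2) (Fin 2) (localField 𝔭))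

/-- The projection `(M ⊗ A[𝔭⁻¹])ˣ → Γ₀`. -/
def Gamma0.mk : (OrderAway 𝔭 M)ˣ →* Gamma0 𝔭 M φ := QuotientGroup.mk' (scalarUnits 𝔭 M)

omit [IsScalarTower k[X] (RatFunc k) B] in
theorem Gamma0.mk_surjective : Function.Surjective (Gamma0.mk (M := M) φ) :=
  QuotientGroup.mk'_surjective _

theorem Gamma0.mk_smul (u : (OrderAway 𝔭 M)ˣ)
    (N : Lattice (localIntegers 𝔭) (localField 𝔭)) :
    Gamma0.mk φ u • Vertex.mk N = Vertex.mk (unitsToGL 𝔭 M φ u • N) := rfl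

omit [IsScalarTower k[X] (RatFunc k) B] in
theorem Gamma0.mk_eq_mk_iff {u u' : (OrderAway 𝔭 M)ˣ} : Gamma0.mk φ u = Gamma0.mk φ u' ↔
    ∃ s : (awayFrom 𝔭)ˣ, 
      (u' : OrderAway 𝔭 M) = (u : OrderAway 𝔭 M) * ((1 : M) ⊗ₜ (s : awayFrom 𝔭)) := by
  refine QuotientGroup.eq.trans ⟨?_, ?_⟩
  · rintro ⟨s, hs⟩
    refine ⟨s, ?_⟩
    rw [eq_inv_mul_iff_mul_eq] at hs
    rw [← hs]
    rfl
  · rintro ⟨s, hs⟩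
    refine ⟨s, ?_⟩
    rw [eq_inv_mul_iff_mul_eq]
    exact Units.ext hs.symm

theorem units_smul_le_of_valued_le {c d : (localField 𝔭)ˣ}
    (h : Valued.v (d : localField 𝔭) ≤ Valued.v (c : localField 𝔭))
    (N : Submodule (localIntegers 𝔭) (Fin 2 → localField 𝔭)) : d • N ≤ c • N := by
  rintro _ ⟨y, hy, rfl⟩
  have h1 : ((c⁻¹ * d : (localField 𝔭)ˣ) : localField 𝔭) ∈
      𝔭.adicCompletionIntegers (RatFunc k) := by
    rw [HeightOneSpectrum.mem_adicCompletionIntegers, Units.val_mul, Units.val_inv_eq_inv_val,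
      map_mul, map_inv₀, inv_mul_le_one₀ (zero_lt_iff.2 ((Valuation.ne_zero_iff _).2 c.ne_zero))]
    exact h
  refine ⟨(⟨_, h1⟩ : localIntegers 𝔭) • y, N.smul_mem _ hy, ?_⟩
  change c • (c⁻¹ * d) • y = d • y
  rw [smul_smul, mul_inv_cancel_left]

theorem units_smul_eq_of_valued_eq {c d : (localField 𝔭)ˣ}
    (h : Valued.v (d : localField 𝔭) = Valued.v (c : localField 𝔭))
    (N : Submodule (localIntegers 𝔭) (Fin 2 → localField 𝔭)) : d • N = c • N :=
  le_antisymm (units_smul_le_of_valued_le h.le N) (units_smul_le_of_valued_le h.ge N)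

/-- Every element of `Γ₀` that fixes the class of a lattice `L` is represented by an element that
fixes `L`. -/
theorem Gamma0.exists_lift_of_smul_eq {γ : Gamma0 𝔭 M φ}
    {L : Lattice (localIntegers 𝔭) (localField 𝔭)} (h : γ • Vertex.mk L = Vertex.mk L) :
    ∃ u, Gamma0.mk φ u = γ ∧ unitsToGL 𝔭 M φ u • L = L := by
  obtain ⟨P, hP⟩ : ∃ P, 𝔭.asIdeal = Ideal.span {P} :=
    (IsPrincipalIdealRing.principal 𝔭.asIdeal).principal
  obtain ⟨s, hs⟩ := exists_unit_awayFrom hP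
  obtain ⟨u, rfl⟩ := Gamma0.mk_surjective φ γ
  rw [Gamma0.mk_smul, Vertex.mk_eq_mk] at h
  obtain ⟨c, hc⟩ := h
  -- scale a representative `u` by a power of the generator `s` of `𝔭`, which is a unit of `A[𝔭⁻¹]`
  let ι : (awayFrom 𝔭)ˣ →* (localField 𝔭)ˣ := Units.map
    ((algebraMap (RatFunc k) (localField 𝔭)).comp (algebraMap (awayFrom 𝔭) (RatFunc k))).toMonoidHom
  let σ : (awayFrom 𝔭)ˣ →* (OrderAway 𝔭 M)ˣ := Units.map (Algebra.TensorProduct.includeRight :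
    awayFrom 𝔭 →ₐ[k[X]] OrderAway 𝔭 M).toMonoidHom
  have hι : ∀ (s' : (awayFrom 𝔭)ˣ) (y : Fin 2 → localField 𝔭),
      (unitsToGL 𝔭 M φ (σ s') : Matrix (Fin 2) (Fin 2) (localField 𝔭)).mulVec y = ι s' • y := by
    intro s' y
    rw [unitsToGL_val, OrderAway.toMatrix_of_toAlg_eq φ
      (f := algebraMap (awayFrom 𝔭) (RatFunc k) (s' : awayFrom 𝔭)), Matrix.smul_mulVec,
      Matrix.one_mulVec]
    · rfl
    · refine (OrderAway.toAlg_tmul _ _).trans ?_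
      rw [OneMemClass.coe_one, one_mul]
      rfl
  have hvs : Valued.v ((ι s : (localField 𝔭)ˣ) : localField 𝔭) = WithZero.exp (-1 : ℤ) := by
    rw [← valuation_generator hP, ← hs]
    exact HeightOneSpectrum.valuedAdicCompletion_eq_valuation' 𝔭 _
  obtain ⟨m, hm⟩ : ∃ m : ℤ, Valued.v (c : localField 𝔭) = WithZero.exp m :=
    ⟨_, (WithZero.exp_log (by simp)).symm⟩
  have hd : Valued.v ((ι (s ^ (-m)) : (localField 𝔭)ˣ) : localField 𝔭) =
      Valued.v (c : localField 𝔭) := by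
    rw [hm, map_zpow, Units.val_zpow_eq_zpow_val, map_zpow₀, hvs, ← WithZero.exp_zsmul]
    simp
  refine ⟨σ (s ^ (-m)) * u, ?_, ?_⟩
  · rw [map_mul]
    have : Gamma0.mk φ (σ (s ^ (-m))) = 1 := (QuotientGroup.eq_one_iff _).2 ⟨_, rfl⟩
    rw [this, one_mul]
  · apply Subtype.ext
    rw [map_mul, mul_smul, hc, ← units_smul_eq_of_valued_eq hd]
    ext x
    rw [Lattice.mem_smul]
    simp only [hι]
    rfl

variable [Nontrivial B]

theorem OrderAway.toAlg_inv_mem_range {u : (OrderAway 𝔭 M)ˣ}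
    (h : OrderAway.toAlg 𝔭 M u ∈ Set.range (algebraMap (RatFunc k) B)) :
    OrderAway.toAlg 𝔭 M (↑u⁻¹ : OrderAway 𝔭 M) ∈ Set.range (algebraMap (RatFunc k) B) := by
  obtain ⟨f, hf⟩ := h
  have h1 : OrderAway.toAlg 𝔭 M (↑u⁻¹ : OrderAway 𝔭 M) * algebraMap (RatFunc k) B f = 1 := by
    rw [hf, ← map_mul, Units.inv_mul, map_one]
  have hf0 : f ≠ 0 := by
    rintro rfl
    simp at h1
  refine ⟨f⁻¹, ?_⟩
  calc algebraMap (RatFunc k) B f⁻¹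
      = OrderAway.toAlg 𝔭 M (↑u⁻¹ : OrderAway 𝔭 M) * algebraMap (RatFunc k) B f *
          algebraMap (RatFunc k) B f⁻¹ := by rw [h1, one_mul]
    _ = _ := by rw [mul_assoc, ← map_mul, mul_inv_cancel₀ hf0, map_one, mul_one]

/-- An element outside `F` of the unit group of the left order of a lattice has its trace and norm
in `k`, and its quadratic polynomial has no root in `k`. -/
theorem exists_const_trace_det (hB : IsDefinite k B) (hM : IsOrderIn (RatFunc k) M)
    {L : Lattice (localIntegers 𝔭) (localField 𝔭)} {u : (OrderAway 𝔭 M)ˣ}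
    (hu : unitsToGL 𝔭 M φ u • L = L)
    (huF : OrderAway.toAlg 𝔭 M u ∉ Set.range (algebraMap (RatFunc k) B)) :
    ∃ t n : k, (OrderAway.toMatrix M φ u).trace = algebraMap k[X] (localField 𝔭) (C t) ∧
      (OrderAway.toMatrix M φ u).det = algebraMap k[X] (localField 𝔭) (C n) ∧
      (u * u : OrderAway 𝔭 M) = algebraMap k[X] (OrderAway 𝔭 M) (C t) * u -
        algebraMap k[X] (OrderAway 𝔭 M) (C n) ∧
      ∀ r : k, r ^ 2 - t * r + n ≠ 0 := by
  obtain ⟨hu1, hu2⟩ := (unitsToGL_smul_eq_iff φ).1 hu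
  have huF' : OrderAway.toAlg 𝔭 M (↑u⁻¹ : OrderAway 𝔭 M) ∉
      Set.range (algebraMap (RatFunc k) B) := fun h =>
    huF (by simpa using OrderAway.toAlg_inv_mem_range h)
  obtain ⟨t, n, ht, hn, htn⟩ := exists_trace_det_of_mem_leftOrder φ hM hu1 huF
  obtain ⟨-, n', -, hn', -⟩ := exists_trace_det_of_mem_leftOrder φ hM hu2 huF'
  have hnn : n * n' = 1 := by
    have hinj : Function.Injective (algebraMap k[X] (localField 𝔭)) := by
      rw [IsScalarTower.algebraMap_eq k[X] (RatFunc k) (localField 𝔭)]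
      exact (algebraMap (RatFunc k) (localField 𝔭)).injective.comp
        (IsFractionRing.injective k[X] (RatFunc k))
    apply hinj
    rw [map_mul, ← hn, ← hn', ← Matrix.det_mul, ← map_mul, Units.mul_inv, map_one, map_one,
      Matrix.det_one]
  obtain ⟨n, -, rfl⟩ := Polynomial.isUnit_iff.1 (IsUnit.of_mul_eq_one _ hnn)
  -- the quadratic polynomial has no root in `F_∞`, which forces its trace to be constant
  have hroot := no_root_of_forall_isUnit hB huF htn
  have ht0 : t.natDegree = 0 := by
    by_contra ht0
    classical
    obtain ⟨r, hr⟩ := exists_root_completionAtInfty ht0 n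
    exact hroot r hr
  obtain ⟨t, rfl⟩ := natDegree_eq_zero.1 ht0
  refine ⟨t, n, ht, hn, OrderAway.toAlg_injective ?_, fun r hr => ?_⟩
  · rw [map_mul, map_sub, map_mul, AlgHom.commutes, AlgHom.commutes, ← sq, htn,
      IsScalarTower.algebraMap_apply k[X] (RatFunc k) B,
      IsScalarTower.algebraMap_apply k[X] (RatFunc k) B, ← Algebra.smul_def,
      Algebra.algebraMap_eq_smul_one (algebraMap k[X] (RatFunc k) (C n))]
  · refine hroot (algebraMap (RatFunc k) _ (algebraMap k[X] (RatFunc k) (C r))) ?_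
    rw [← map_pow, ← map_pow, ← map_mul, ← map_mul, ← map_sub, ← map_sub, ← map_add, ← map_add,
      ← C_pow, ← C_mul, ← C_sub, ← C_add, hr]
    simp

/-- An element of `F` in the unit group of the left order of a lattice is trivial in `Γ₀`. -/
theorem Gamma0.mk_eq_one (hM : IsOrderIn (RatFunc k) M)
    {L : Lattice (localIntegers 𝔭) (localField 𝔭)} {u : (OrderAway 𝔭 M)ˣ}
    (hu : unitsToGL 𝔭 M φ u • L = L)
    (huF : OrderAway.toAlg 𝔭 M u ∈ Set.range (algebraMap (RatFunc k) B)) :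
    Gamma0.mk φ u = 1 := by
  obtain ⟨hu1, hu2⟩ := (unitsToGL_smul_eq_iff φ).1 hu
  obtain ⟨a, ha⟩ := exists_eq_algebraMap_of_mem_leftOrder φ hM hu1 huF
  obtain ⟨b, hb⟩ := exists_eq_algebraMap_of_mem_leftOrder φ hM hu2
    (OrderAway.toAlg_inv_mem_range huF)
  have hinj : Function.Injective (algebraMap k[X] (OrderAway 𝔭 M)) := by
    have h1 : (OrderAway.toAlg 𝔭 M : OrderAway 𝔭 M → B) ∘ algebraMap k[X] (OrderAway 𝔭 M) =
        algebraMap (RatFunc k) B ∘ algebraMap k[X] (RatFunc k) := by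
      funext a
      rw [Function.comp_apply, AlgHom.commutes, IsScalarTower.algebraMap_apply k[X] (RatFunc k) B]
      rfl
    refine Function.Injective.of_comp (f := OrderAway.toAlg 𝔭 M) ?_
    rw [h1]
    exact (algebraMap (RatFunc k) B).injective.comp (IsFractionRing.injective k[X] (RatFunc k))
  have hab : a * b = 1 := hinj (by rw [map_mul, ← ha, ← hb, Units.mul_inv, map_one])
  let a' : k[X]ˣ := ⟨a, b, hab, by rw [mul_comm, hab]⟩
  rw [eq_comm, ← map_one (Gamma0.mk φ), Gamma0.mk_eq_mk_iff]
  refine ⟨Units.map (algebraMap k[X] (awayFrom 𝔭)).toMonoidHom a', ?_⟩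
  rw [Units.val_one, one_mul, ha]
  exact Algebra.TensorProduct.algebraMap_apply' a

end Gamma

/-! ### The stabilizer of a vertex of weight `q + 1` -/

/-- If `u² - tu + n = 0` and `X² - tX + n` has no root in `k`, then `a + u` is a unit for `a ∈ k`,
with inverse `(a + t - u) / (a² + at + n)`. -/
theorem exists_unit_add_algebraMap {k S : Type*} [Field k] [Ring S] [Algebra k[X] S] {u : S}
    {t n : k} (hu : u * u = algebraMap k[X] S (C t) * u - algebraMap k[X] S (C n))
    (h : ∀ r : k, r ^ 2 - t * r + n ≠ 0) (a : k) :
    ∃ w : Sˣ, (w : S) = algebraMap k[X] S (C a) + u ∧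
      ∀ Λ : Subalgebra k[X] S, u ∈ Λ → (w : S) ∈ Λ ∧ (↑w⁻¹ : S) ∈ Λ := by
  have hc : a ^ 2 + a * t + n ≠ 0 := fun h' => h (-a) (by rw [← h']; ring)
  set ι := algebraMap k[X] S with hι
  have hcomm : ∀ b : k, u * ι (C b) = ι (C b) * u := fun b => (Algebra.commutes _ _).symm
  have hprod : (ι (C a) + u) * (ι (C (a + t)) - u) = ι (C (a ^ 2 + a * t + n)) := by
    have h1 : (ι (C a) + u) * (ι (C (a + t)) - u) =
        ι (C a) * ι (C (a + t)) - ι (C a) * u + u * ι (C (a + t)) - u * u := by noncomm_ring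
    have h2 : a * (a + t) = a ^ 2 + a * t := by ring
    rw [h1, hcomm, hu, ← map_mul ι (C a), ← C_mul, h2]
    simp only [map_add, add_mul]
    abel
  have hcommu : Commute (ι (C a) + u) (ι (C (a + t)) - u) :=
    (Commute.add_left (Commute.sub_right (Algebra.commute_algebraMap_left _ _)
      (Algebra.commute_algebraMap_left _ _))
      (Commute.sub_right (Algebra.commute_algebraMap_right _ _) (Commute.refl u)))
  have hinv : ι (C (a ^ 2 + a * t + n)) * ι (C (a ^ 2 + a * t + n)⁻¹) = 1 := by
    rw [← map_mul, ← C_mul, mul_inv_cancel₀ hc, C_1, map_one]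
  refine ⟨⟨ι (C a) + u, (ι (C (a + t)) - u) * ι (C (a ^ 2 + a * t + n)⁻¹), ?_, ?_⟩, rfl,
    fun Λ hΛ => ⟨?_, ?_⟩⟩
  · rw [← mul_assoc, hprod, hinv]
  · rw [mul_assoc, Algebra.commutes, ← mul_assoc, ← hcommu.eq, hprod, hinv]
  · exact Λ.add_mem (Λ.algebraMap_mem _) hΛ
  · exact Λ.mul_mem (Λ.sub_mem (Λ.algebraMap_mem _) hΛ) (Λ.algebraMap_mem _)

section Gamma

open BruhatTits

variable {k : Type*} [Field k] {𝔭 : HeightOneSpectrum k[X]}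
  {B : Type*} [Ring B] [Algebra k[X] B] {M : Subalgebra k[X] B}
  [Algebra (RatFunc k) B] [IsScalarTower k[X] (RatFunc k) B]
  (φ : localField 𝔭 ⊗[RatFunc k] B ≃ₐ[localField 𝔭] Matrix (Fin 2) (Fin 2) (localField 𝔭))

theorem Gamma0.exists_toAlg_eq_of_mk_eq_mk {u u' : (OrderAway 𝔭 M)ˣ}
    (h : Gamma0.mk φ u = Gamma0.mk φ u') : ∃ s : RatFunc k,
      OrderAway.toAlg 𝔭 M u' = s • OrderAway.toAlg 𝔭 M u := by
  obtain ⟨s, hs⟩ := (Gamma0.mk_eq_mk_iff φ).1 h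
  refine ⟨(s : awayFrom 𝔭), ?_⟩
  rw [hs, map_mul, OrderAway.toAlg_tmul, OneMemClass.coe_one, one_mul, Algebra.smul_def,
    Algebra.commutes]

theorem Gamma0.mk_smul_mk_eq {w : (OrderAway 𝔭 M)ˣ}
    {N : Lattice (localIntegers 𝔭) (localField 𝔭)}
    (h : (w : OrderAway 𝔭 M) ∈ leftOrder M φ N.1 ∧
      (↑w⁻¹ : OrderAway 𝔭 M) ∈ leftOrder M φ N.1) :
    Gamma0.mk φ w • Vertex.mk N = Vertex.mk N := by
  rw [Gamma0.mk_smul, (unitsToGL_smul_eq_iff φ).2 h]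

variable [Nontrivial B] [Finite k]

/-- If the stabilizer of the class of `L` in `Γ₀` has order `q + 1`, then the `q + 1` classes of `1`
and of `a + u`, `a ∈ k`, exhaust it, for any representative `u` of a non-trivial element. Hence all
its elements have representatives that, with their inverses, lie in every subalgebra that contains
`u`. -/
theorem Gamma0.exists_lift_mem (hB : IsDefinite k B) (hM : IsOrderIn (RatFunc k) M)
    {L : Lattice (localIntegers 𝔭) (localField 𝔭)}
    (hcard : Nat.card (MulAction.stabilizer (Gamma0 𝔭 M φ) (Vertex.mk L)) = Nat.card k + 1)
    {u : (OrderAway 𝔭 M)ˣ} (hu : unitsToGL 𝔭 M φ u • L = L)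
    (huF : OrderAway.toAlg 𝔭 M u ∉ Set.range (algebraMap (RatFunc k) B))
    {γ : Gamma0 𝔭 M φ} (hγ : γ • Vertex.mk L = Vertex.mk L) :
    ∃ w, Gamma0.mk φ w = γ ∧ ∀ Λ : Subalgebra k[X] (OrderAway 𝔭 M), (u : OrderAway 𝔭 M) ∈ Λ →
      (w : OrderAway 𝔭 M) ∈ Λ ∧ (↑w⁻¹ : OrderAway 𝔭 M) ∈ Λ := by
  obtain ⟨t, n, -, -, hsq, hroot⟩ := exists_const_trace_det φ hB hM hu huF
  choose w hw hwΛ using exists_unit_add_algebraMap (S := OrderAway 𝔭 M) hsq hroot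
  have huL := ((unitsToGL_smul_eq_iff φ).1 hu).1
  have hwB : ∀ a, OrderAway.toAlg 𝔭 M (w a) =
      algebraMap k[X] (RatFunc k) (C a) • (1 : B) + OrderAway.toAlg 𝔭 M u := fun a => by
    rw [hw, map_add, AlgHom.commutes, IsScalarTower.algebraMap_apply k[X] (RatFunc k) B,
      Algebra.algebraMap_eq_smul_one (algebraMap k[X] (RatFunc k) (C a))]
  let f : Option k → MulAction.stabilizer (Gamma0 𝔭 M φ) (Vertex.mk L) := fun a =>
    a.elim 1 fun a => ⟨Gamma0.mk φ (w a), Gamma0.mk_smul_mk_eq φ (hwΛ a _ huL)⟩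
  have hone : ∀ a, Gamma0.mk φ 1 ≠ Gamma0.mk φ (w a) := by
    intro a ha
    obtain ⟨s, hs⟩ := Gamma0.exists_toAlg_eq_of_mk_eq_mk φ ha
    rw [hwB, Units.val_one, map_one] at hs
    exact smul_one_add_ne_smul_one huF hs
  have hf : Function.Injective f := by
    rintro (_ | a) (_ | b) hab
    · rfl
    · exact absurd (congrArg Subtype.val hab) (by simpa [f] using hone b)
    · exact absurd (congrArg Subtype.val hab) (by simpa [f, eq_comm] using hone a)
    · have h1 : Gamma0.mk φ (w a) = Gamma0.mk φ (w b) := congrArg Subtype.val hab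
      obtain ⟨s, hs⟩ := Gamma0.exists_toAlg_eq_of_mk_eq_mk φ h1
      rw [hwB, hwB] at hs
      have h2 := eq_of_smul_one_add_eq_smul huF hs
      rw [C_injective (IsFractionRing.injective k[X] (RatFunc k) h2)]
  have hfin : Finite (MulAction.stabilizer (Gamma0 𝔭 M φ) (Vertex.mk L)) :=
    Nat.finite_of_card_ne_zero (by rw [hcard]; exact Nat.succ_ne_zero _)
  have hbij := hf.bijective_of_nat_card_le (by rw [hcard, Finite.card_option])
  obtain ⟨a, ha⟩ := hbij.2 ⟨γ, hγ⟩
  have ha' := congrArg Subtype.val ha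
  cases a with
  | none => exact ⟨1, (map_one _).trans ha', fun Λ _ => by simp⟩
  | some a => exact ⟨w a, ha', hwΛ a⟩

/-- The stabilizer of an edge from the class of `N` to the class of `L` is the whole stabilizer of
the class of `L` if `u` maps `N` to itself, and is trivial otherwise. -/
theorem card_stabilizer_edge (hB : IsDefinite k B) (hM : IsOrderIn (RatFunc k) M)
    {L : Lattice (localIntegers 𝔭) (localField 𝔭)}
    (hcard : Nat.card (MulAction.stabilizer (Gamma0 𝔭 M φ) (Vertex.mk L)) = Nat.card k + 1)
    {u : (OrderAway 𝔭 M)ˣ} (hu : unitsToGL 𝔭 M φ u • L = L)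
    (huF : OrderAway.toAlg 𝔭 M u ∉ Set.range (algebraMap (RatFunc k) B))
    {ϖ : localIntegers 𝔭} (hϖ : Irreducible ϖ) {N : Lattice (localIntegers 𝔭) (localField 𝔭)}
    (h1 : ϖ • L.1 < N.1) (h2 : N.1 < L.1) {e : Edge (localIntegers 𝔭) (localField 𝔭)}
    (he : e.1 = (Vertex.mk N, Vertex.mk L)) :
    ((u : OrderAway 𝔭 M) ∈ leftOrder M φ N.1 →
      Nat.card (MulAction.stabilizer (Gamma0 𝔭 M φ) e) = Nat.card k + 1) ∧
    ((u : OrderAway 𝔭 M) ∉ leftOrder M φ N.1 →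
      Nat.card (MulAction.stabilizer (Gamma0 𝔭 M φ) e) = 1) := by
  have hstab : ∀ γ : Gamma0 𝔭 M φ, γ ∈ MulAction.stabilizer (Gamma0 𝔭 M φ) e ↔
      γ • Vertex.mk N = Vertex.mk N ∧ γ • Vertex.mk L = Vertex.mk L := by
    intro γ
    rw [MulAction.mem_stabilizer_iff, Subtype.ext_iff, Prod.ext_iff]
    change γ • e.1.1 = e.1.1 ∧ γ • e.1.2 = e.1.2 ↔ _
    rw [he]
  constructor
  · intro huN
    rw [← hcard]
    congr 2
    ext γ
    rw [hstab, MulAction.mem_stabilizer_iff]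
    refine ⟨And.right, fun h => ⟨?_, h⟩⟩
    obtain ⟨w, rfl, hw⟩ := Gamma0.exists_lift_mem φ hB hM hcard hu huF h
    exact Gamma0.mk_smul_mk_eq φ (hw _ huN)
  · intro huN
    have hbot : MulAction.stabilizer (Gamma0 𝔭 M φ) e = ⊥ := by
      rw [eq_bot_iff]
      intro γ hγ
      rw [hstab] at hγ
      rw [Subgroup.mem_bot]
      by_contra hne
      obtain ⟨u₁, rfl, hu₁⟩ := Gamma0.exists_lift_of_smul_eq φ hγ.2
      have hu₁F : OrderAway.toAlg 𝔭 M u₁ ∉ Set.range (algebraMap (RatFunc k) B) :=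
        fun h => hne (Gamma0.mk_eq_one φ hM hu₁ h)
      have hu₁N := (unitsToGL_smul_eq_iff φ).1 (Lattice.smul_eq_of_smul_mk_eq hϖ h1 h2 hu₁ hγ.1)
      -- the class of `u` has a representative in the algebra generated by `u₁`, so `u` fixes `N`
      have hmem : Gamma0.mk φ u • Vertex.mk L = Vertex.mk L := by rw [Gamma0.mk_smul, hu]
      obtain ⟨w, hwu, hw⟩ := Gamma0.exists_lift_mem φ hB hM hcard hu₁ hu₁F hmem
      have h3 : Gamma0.mk φ u • Vertex.mk N = Vertex.mk N := by
        rw [← hwu]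
        exact Gamma0.mk_smul_mk_eq φ (hw _ hu₁N.1)
      exact huN ((unitsToGL_smul_eq_iff φ).1 (Lattice.smul_eq_of_smul_mk_eq hϖ h1 h2 hu h3)).1
    rw [hbot, Subgroup.card_bot]

end Gamma

end

/-! ### Edges of weight `q + 1` -/

open BruhatTits IsLocalRing in
theorem lemma3p1 {k : Type*} [Field k] [Finite k]
    (𝔭 : HeightOneSpectrum k[X])
    {B : Type*} [Ring B] [Algebra (RatFunc k) B] [IsQuaternionAlgebra (RatFunc k) B]
    [Algebra k[X] B] [IsScalarTower k[X] (RatFunc k) B]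
    (hB : IsDefinite k B)
    (φ : localField 𝔭 ⊗[RatFunc k] B ≃ₐ[localField 𝔭] Matrix (Fin 2) (Fin 2) (localField 𝔭))
    (M : Subalgebra k[X] B) (hM : IsMaximalOrder (RatFunc k) M)
    (v : MulAction.orbitRel.Quotient (Gamma0 𝔭 M φ)
      (BruhatTits.Vertex (localIntegers 𝔭) (localField 𝔭)))
    (hv : (graphG0 𝔭 M φ).wV v = Nat.card k + 1) :
    (∀ e, (graphG0 𝔭 M φ).t e = v →
      (graphG0 𝔭 M φ).wE e = 1 ∨ (graphG0 𝔭 M φ).wE e = Nat.card k + 1) ∧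
    {e | (graphG0 𝔭 M φ).t e = v ∧ (graphG0 𝔭 M φ).wE e = Nat.card k + 1}.Finite ∧
    (({e | (graphG0 𝔭 M φ).t e = v ∧
        (graphG0 𝔭 M φ).wE e = Nat.card k + 1}.ncard : ℕ) : ℤ) =
      1 + (-1) ^ idealDegree 𝔭.asIdeal := by
  have hM' : IsOrderIn (RatFunc k) M := hM.prop
  obtain ⟨v₀, rfl⟩ := Quotient.exists_rep v
  obtain ⟨L, rfl⟩ : ∃ L, Vertex.mk L = v₀ := Quotient.exists_rep v₀
  obtain ⟨ϖ, hϖ⟩ := IsDiscreteValuationRing.exists_irreducible (localIntegers 𝔭)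
  have hcard : Nat.card (MulAction.stabilizer (Gamma0 𝔭 M φ) (Vertex.mk L)) = Nat.card k + 1 :=
    (mul_one _).symm.trans hv
  have hq : 1 < Nat.card k := Finite.one_lt_card
  -- a non-trivial element of the stabilizer
  obtain ⟨u, hu, huF⟩ : ∃ u : (OrderAway 𝔭 M)ˣ, unitsToGL 𝔭 M φ u • L = L ∧
      OrderAway.toAlg 𝔭 M u ∉ Set.range (algebraMap (RatFunc k) B) := by
    have : Finite (MulAction.stabilizer (Gamma0 𝔭 M φ) (Vertex.mk L)) :=
      Nat.finite_of_card_ne_zero (by omega)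
    have : Nontrivial (MulAction.stabilizer (Gamma0 𝔭 M φ) (Vertex.mk L)) :=
      Finite.one_lt_card_iff_nontrivial.1 (by omega)
    obtain ⟨⟨γ, hγ⟩, hγ1⟩ :=
      exists_ne (1 : MulAction.stabilizer (Gamma0 𝔭 M φ) (Vertex.mk L))
    obtain ⟨u, rfl, hu⟩ := Gamma0.exists_lift_of_smul_eq φ hγ
    exact ⟨u, hu, fun h => hγ1 (Subtype.ext (Gamma0.mk_eq_one φ hM' hu h))⟩
  -- the edges with terminus `v`
  have hedge : ∀ e, (graphG0 𝔭 M φ).t e = Quotient.mk _ (Vertex.mk L) →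
      ∃ N : Lattice (localIntegers 𝔭) (localField 𝔭), ϖ • L.1 < N.1 ∧ N.1 < L.1 ∧
        ∃ e' : Edge (localIntegers 𝔭) (localField 𝔭), e'.1 = (Vertex.mk N, Vertex.mk L) ∧
          e = Quotient.mk _ e' := by
    intro e he
    obtain ⟨e, rfl⟩ := Quotient.exists_rep e
    obtain ⟨γ, hγ⟩ : ∃ γ : Gamma0 𝔭 M φ, γ • Vertex.mk L = e.1.2 := Quotient.exact he
    have hadj := (γ⁻¹ • e).2
    have h2 : (γ⁻¹ • e).1.2 = Vertex.mk L := by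
      change γ⁻¹ • e.1.2 = _
      rw [← hγ, inv_smul_smul]
    rw [h2] at hadj
    obtain ⟨N, hN, hN1, hN2⟩ := (adj_mk_iff hϖ).1 hadj
    exact ⟨N, hN1, hN2, γ⁻¹ • e, Prod.ext hN.symm h2, Quotient.sound ⟨γ, smul_inv_smul γ e⟩⟩
  have hwE : ∀ e : Edge (localIntegers 𝔭) (localField 𝔭),
      (graphG0 𝔭 M φ).wE (Quotient.mk _ e) =
        Nat.card (MulAction.stabilizer (Gamma0 𝔭 M φ) e) := fun e => mul_one _
  have hstab : ∀ {N : Lattice (localIntegers 𝔭) (localField 𝔭)} (_ : ϖ • L.1 < N.1)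
      (_ : N.1 < L.1) {e : Edge (localIntegers 𝔭) (localField 𝔭)}
      (_ : e.1 = (Vertex.mk N, Vertex.mk L)), _ := fun h1 h2 _ he =>
    card_stabilizer_edge φ hB hM' hcard hu huF hϖ h1 h2 he
  refine ⟨?_, ?_⟩
  · intro e he
    obtain ⟨N, h1, h2, e, he', rfl⟩ := hedge e he
    rw [hwE]
    by_cases huN : (u : OrderAway 𝔭 M) ∈ leftOrder M φ N.1
    · exact Or.inr ((hstab h1 h2 he').1 huN)
    · exact Or.inl ((hstab h1 h2 he').2 huN)
  obtain ⟨t, n, ht, hn, -, hroot⟩ := exists_const_trace_det φ hB hM' hu huF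
  have huL := ((unitsToGL_smul_eq_iff φ).1 hu).1
  rw [IsScalarTower.algebraMap_apply k[X] (localIntegers 𝔭) (localField 𝔭)] at ht hn
  let i : k →+* ResidueField (localIntegers 𝔭) :=
    ((residue (localIntegers 𝔭)).comp (algebraMap k[X] (localIntegers 𝔭))).comp C
  rcases Nat.even_or_odd (idealDegree 𝔭.asIdeal) with hd | hd
  · obtain ⟨a, b, hab, hat, han⟩ := exists_two_roots_of_even i (card_residueField 𝔭) hd hroot
    obtain ⟨N₁, N₂, hne, hN⟩ := L.exists_two_invariant_sublattices hϖ huL ht hn hab hat han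
    obtain ⟨h11, h12, h13⟩ := (hN N₁).2 (Or.inl rfl)
    obtain ⟨h21, h22, h23⟩ := (hN N₂).2 (Or.inr rfl)
    let L₁ : Lattice (localIntegers 𝔭) (localField 𝔭) := ⟨N₁, isLattice_of_between hϖ h11 h12⟩
    let L₂ : Lattice (localIntegers 𝔭) (localField 𝔭) := ⟨N₂, isLattice_of_between hϖ h21 h22⟩
    let e₁ : Edge (localIntegers 𝔭) (localField 𝔭) :=
      ⟨(Vertex.mk L₁, Vertex.mk L), (adj_mk_iff hϖ).2 ⟨L₁, rfl, h11, h12⟩⟩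
    let e₂ : Edge (localIntegers 𝔭) (localField 𝔭) :=
      ⟨(Vertex.mk L₂, Vertex.mk L), (adj_mk_iff hϖ).2 ⟨L₂, rfl, h21, h22⟩⟩
    have hset : {e | (graphG0 𝔭 M φ).t e = Quotient.mk _ (Vertex.mk L) ∧
        (graphG0 𝔭 M φ).wE e = Nat.card k + 1} = {Quotient.mk _ e₁, Quotient.mk _ e₂} := by
      ext e
      constructor
      · rintro ⟨he, hw⟩
        obtain ⟨N, h1, h2, e, he', rfl⟩ := hedge e he
        rw [hwE] at hw
        have huN : (u : OrderAway 𝔭 M) ∈ leftOrder M φ N.1 := by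
          by_contra huN
          rw [(hstab h1 h2 he').2 huN] at hw
          omega
        rcases (hN N.1).1 ⟨h1, h2, huN⟩ with h | h
        · have : N = L₁ := Subtype.ext h
          subst this
          exact Or.inl (congrArg _ (Subtype.ext he'))
        · have : N = L₂ := Subtype.ext h
          subst this
          exact Or.inr (congrArg _ (Subtype.ext he'))
      · rintro (rfl | rfl)
        · exact ⟨rfl, (hwE _).trans ((hstab (N := L₁) h11 h12 rfl).1 h13)⟩
        · exact ⟨rfl, (hwE _).trans ((hstab (N := L₂) h21 h22 rfl).1 h23)⟩
    -- the two edges are fixed by the stabilizer of `v`, so they are in different orbits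
    have hne' : (Quotient.mk _ e₁ : MulAction.orbitRel.Quotient (Gamma0 𝔭 M φ) _) ≠
        Quotient.mk _ e₂ := by
      intro h
      obtain ⟨γ, hγ⟩ : ∃ γ : Gamma0 𝔭 M φ, γ • e₂ = e₁ := Quotient.exact h
      have hγN : γ • Vertex.mk L₂ = Vertex.mk L₁ := congrArg (fun e => e.1.1) hγ
      have hγL : γ • Vertex.mk L = Vertex.mk L := congrArg (fun e => e.1.2) hγ
      obtain ⟨w, rfl, hw⟩ := Gamma0.exists_lift_mem φ hB hM' hcard hu huF hγL
      rw [Gamma0.mk_smul_mk_eq φ (N := L₂) (hw _ h23)] at hγN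
      obtain ⟨c, hc⟩ := Vertex.mk_eq_mk.1 hγN
      exact hne (eq_of_homothetic hϖ h21 h22 h11 h12 hc)
    rw [hset]
    refine ⟨Set.toFinite _, ?_⟩
    rw [Set.ncard_pair hne', hd.neg_one_pow]
    norm_num
  · have hno := no_root_of_odd i (card_residueField 𝔭) (Nat.not_even_iff_odd.2 hd) hroot
    have hset : {e | (graphG0 𝔭 M φ).t e = Quotient.mk _ (Vertex.mk L) ∧
        (graphG0 𝔭 M φ).wE e = Nat.card k + 1} = ∅ := by
      rw [Set.eq_empty_iff_forall_notMem]
      rintro e ⟨he, hw⟩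
      obtain ⟨N, h1, h2, e, he', rfl⟩ := hedge e he
      rw [hwE, (hstab h1 h2 he').2 (L.no_invariant_sublattice hϖ huL ht hn hno h1 h2)] at hw
      omega
    rw [hset]
    refine ⟨Set.finite_empty, ?_⟩
    rw [Set.ncard_empty, hd.neg_one_pow]
    norm_num
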